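/- A \emph{permutation} is a finite (possibly empty) set with two linear orders $<_1,<_2$, and $\mathcal L_P=\{<_1,<_2\}$ (with equality) is the language of permutations. Let $M$ be a finite matrix with entries in $\{0,1,-1\}$. Its \emph{standard figure} is the following subset of the plane: lay out a grid of unit squares, one for each entry of $M$; in each cell with entry $1$ draw the open segment from the bottom left to the top right corner, in each cell with entry $-1$ the open segment from the top left to the bottom right corner, and leave cells with entry $0$ empty. The \emph{geometric grid class} $\mathrm{Geom}(M)$ is the class of all permutations that can be represented by finitely many points on the standard figure of $M$, no two with the same $x$- or the same $y$-coordinate, $<_1$ being the left-to-right order and $<_2$ the bottom-to-top order of the points. Its monadic second-order theory $\mathrm{Th}(\mathrm{Geom}(M))$ is the set of all monadic second-order $\mathcal L_P$-sentences (with variables and quantifiers for elements and for subsets) that hold in every member of $\mathrm{Geom}(M)$. \textbf{Corollary.} It is computable from $M$ whether any given monadic second-order $\mathcal L_P$-sentence $\theta$ is in $\mathrm{Th}(\mathrm{Geom}(M))$. That is, there is a single algorithm which, given a finite matrix $M$ with entries in $\{0,1,-1\}$ and a monadic second-order $\mathcal L_P$-sentence $\theta$, decides whether $\theta\in\mathrm{Th}(\mathrm{Geom}(M))$.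 -/

import Mathlib

/-! ### Permutations and geometric grid classes -/

/-- A (finite) permutation: a finite set equipped with two strict linear orders `<₁` and `<₂`. -/
structure FinPermutation where
  carrier : Type
  finite_carrier : Finite carrier
  lt₁ : carrier → carrier → Prop
  lt₂ : carrier → carrier → Prop
  strictTotal₁ : IsStrictTotalOrder carrier lt₁
  strictTotal₂ : IsStrictTotalOrder carrier lt₂

/-- The standard figure of an `m × n` matrix with entries in `{0, 1, -1}`. The grid is laid out as
the matrix is written: column `j` (counted from the left, starting from `0`) is the strip
`j ≤ x ≤ j + 1`, and row `i` (counted from the top, starting from `0`) is the strip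
`m - 1 - i ≤ y ≤ m - i`. A cell with entry `1` carries the open segment from its bottom left to its
top right corner, a cell with entry `-1` the open segment from its top left to its bottom right
corner. -/
def standardFigure {m n : ℕ} (M : Matrix (Fin m) (Fin n) SignType) : Set (ℝ × ℝ) :=
  {p | ∃ (i : Fin m) (j : Fin n) (t : ℝ), 0 < t ∧ t < 1 ∧
    ((M i j = 1 ∧ p = ((j : ℝ) + t, ((m : ℝ) - 1 - (i : ℝ)) + t)) ∨
     (M i j = -1 ∧ p = ((j : ℝ) + t, ((m : ℝ) - (i : ℝ)) - t)))}

/-- The geometric grid class of `M`: the permutations that can be represented by points drawn on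
the standard figure of `M`, `<₁` being the left-to-right and `<₂` the bottom-to-top order. As `<₁`
and `<₂` are total, distinct points have distinct `x`- and distinct `y`-coordinates. -/
def geomClass {m n : ℕ} (M : Matrix (Fin m) (Fin n) SignType) : Set FinPermutation :=
  {π | ∃ pt : π.carrier → ℝ × ℝ,
    (∀ a, pt a ∈ standardFigure M) ∧
    (∀ a b, π.lt₁ a b ↔ (pt a).1 < (pt b).1) ∧
    (∀ a b, π.lt₂ a b ↔ (pt a).2 < (pt b).2)}

/-! ### Monadic second-order logic of permutations -/

/-- Formulas of monadic second-order logic in the language `{<₁, <₂}` (with equality). Element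
variables and set variables are two separate sorts, each named by natural numbers. -/
inductive MSOFormula : Type
  /-- `x = y` -/
  | eq (x y : ℕ) : MSOFormula
  /-- `x <₁ y` -/
  | lt₁ (x y : ℕ) : MSOFormula
  /-- `x <₂ y` -/
  | lt₂ (x y : ℕ) : MSOFormula
  /-- `x ∈ X` -/
  | mem (x X : ℕ) : MSOFormula
  | neg (φ : MSOFormula) : MSOFormula
  | conj (φ ψ : MSOFormula) : MSOFormula
  | disj (φ ψ : MSOFormula) : MSOFormula
  | imp (φ ψ : MSOFormula) : MSOFormula
  | iff (φ ψ : MSOFormula) : MSOFormula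
  /-- `∃ x, φ` for an element variable `x` -/
  | ex (x : ℕ) (φ : MSOFormula) : MSOFormula
  /-- `∀ x, φ` for an element variable `x` -/
  | all (x : ℕ) (φ : MSOFormula) : MSOFormula
  /-- `∃ X, φ` for a set variable `X` -/
  | exSet (X : ℕ) (φ : MSOFormula) : MSOFormula
  /-- `∀ X, φ` for a set variable `X` -/
  | allSet (X : ℕ) (φ : MSOFormula) : MSOFormula

namespace MSOFormula

/-- The free element variables of a formula. -/
def freeElem : MSOFormula → Finset ℕ
  | eq x y => {x, y}
  | lt₁ x y => {x, y}
  | lt₂ x y => {x, y}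
  | mem x _ => {x}
  | neg φ => φ.freeElem
  | conj φ ψ => φ.freeElem ∪ ψ.freeElem
  | disj φ ψ => φ.freeElem ∪ ψ.freeElem
  | imp φ ψ => φ.freeElem ∪ ψ.freeElem
  | iff φ ψ => φ.freeElem ∪ ψ.freeElem
  | ex x φ => φ.freeElem.erase x
  | all x φ => φ.freeElem.erase x
  | exSet _ φ => φ.freeElem
  | allSet _ φ => φ.freeElem

/-- The free set variables of a formula. -/
def freeSet : MSOFormula → Finset ℕ
  | eq _ _ => ∅
  | lt₁ _ _ => ∅
  | lt₂ _ _ => ∅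
  | mem _ X => {X}
  | neg φ => φ.freeSet
  | conj φ ψ => φ.freeSet ∪ ψ.freeSet
  | disj φ ψ => φ.freeSet ∪ ψ.freeSet
  | imp φ ψ => φ.freeSet ∪ ψ.freeSet
  | iff φ ψ => φ.freeSet ∪ ψ.freeSet
  | ex _ φ => φ.freeSet
  | all _ φ => φ.freeSet
  | exSet X φ => φ.freeSet.erase X
  | allSet X φ => φ.freeSet.erase X

/-- A sentence is a formula without free variables. -/
def IsSentence (φ : MSOFormula) : Prop :=
  φ.freeElem = ∅ ∧ φ.freeSet = ∅

/-- Satisfaction of a formula in a permutation, under an assignment `v` of the element variables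
and `V` of the set variables. Element assignments are partial, so that they also exist on the empty
permutation; every free variable of a subformula of a sentence has a value by the time the
subformula is evaluated. -/
def Sat (π : FinPermutation) :
    MSOFormula → (ℕ → Option π.carrier) → (ℕ → Set π.carrier) → Prop
  | eq x y, v, _ => ∃ a b, v x = some a ∧ v y = some b ∧ a = b
  | lt₁ x y, v, _ => ∃ a b, v x = some a ∧ v y = some b ∧ π.lt₁ a b
  | lt₂ x y, v, _ => ∃ a b, v x = some a ∧ v y = some b ∧ π.lt₂ a b
  | mem x X, v, V => ∃ a, v x = some a ∧ a ∈ V X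
  | neg φ, v, V => ¬ φ.Sat π v V
  | conj φ ψ, v, V => φ.Sat π v V ∧ ψ.Sat π v V
  | disj φ ψ, v, V => φ.Sat π v V ∨ ψ.Sat π v V
  | imp φ ψ, v, V => φ.Sat π v V → ψ.Sat π v V
  | iff φ ψ, v, V => (φ.Sat π v V ↔ ψ.Sat π v V)
  | ex x φ, v, V => ∃ a : π.carrier, φ.Sat π (Function.update v x (some a)) V
  | all x φ, v, V => ∀ a : π.carrier, φ.Sat π (Function.update v x (some a)) V
  | exSet X φ, v, V => ∃ A : Set π.carrier, φ.Sat π v (Function.update V X A)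
  | allSet X φ, v, V => ∀ A : Set π.carrier, φ.Sat π v (Function.update V X A)

/-- `π ⊨ θ`, for a sentence `θ`: satisfaction, starting from the empty assignment. -/
def Models (π : FinPermutation) (θ : MSOFormula) : Prop :=
  θ.Sat π (fun _ => none) (fun _ => ∅)

/-! ### Formulas as inputs of algorithms -/

/-- The Gödel number of a formula: the remainder modulo `13` names the outermost symbol, the
quotient codes its arguments. -/
def toNat : MSOFormula → ℕ
  | eq x y => 13 * Nat.pair x y
  | lt₁ x y => 13 * Nat.pair x y + 1
  | lt₂ x y => 13 * Nat.pair x y + 2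
  | mem x X => 13 * Nat.pair x X + 3
  | neg φ => 13 * φ.toNat + 4
  | conj φ ψ => 13 * Nat.pair φ.toNat ψ.toNat + 5
  | disj φ ψ => 13 * Nat.pair φ.toNat ψ.toNat + 6
  | imp φ ψ => 13 * Nat.pair φ.toNat ψ.toNat + 7
  | iff φ ψ => 13 * Nat.pair φ.toNat ψ.toNat + 8
  | ex x φ => 13 * Nat.pair x φ.toNat + 9
  | all x φ => 13 * Nat.pair x φ.toNat + 10
  | exSet X φ => 13 * Nat.pair X φ.toNat + 11
  | allSet X φ => 13 * Nat.pair X φ.toNat + 12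

theorem toNat_injective : Function.Injective toNat := by
  have cancel : ∀ {a b c : ℕ}, 13 * a + c = 13 * b + c → a = b := fun h => by omega
  intro φ
  induction φ with
  | eq =>
    intro χ h
    cases χ <;> simp only [toNat] at h <;>
      first
      | omega
      | (obtain ⟨rfl, rfl⟩ := Nat.pair_eq_pair.1 (cancel (c := 0) h)
         rfl)
  | lt₁ | lt₂ | mem =>
    intro χ h
    cases χ <;> simp only [toNat] at h <;>
      first
      | omega
      | (have h2 := cancel h
         obtain ⟨rfl, rfl⟩ := Nat.pair_eq_pair.1 h2
         rfl)
  | neg φ ih =>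
    intro χ h
    cases χ <;> simp only [toNat] at h <;>
      first
      | omega
      | (have h2 := cancel h
         rw [ih h2])
  | conj φ ψ ih ih' | disj φ ψ ih ih' | imp φ ψ ih ih' | iff φ ψ ih ih' =>
    intro χ h
    cases χ <;> simp only [toNat] at h <;>
      first
      | omega
      | (have h2 := cancel h
         obtain ⟨h3, h4⟩ := Nat.pair_eq_pair.1 h2
         rw [ih h3, ih' h4])
  | ex x φ ih | all x φ ih | exSet x φ ih | allSet x φ ih =>
    intro χ h
    cases χ <;> simp only [toNat] at h <;>
      first
      | omega
      | (have h2 := cancel h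
         obtain ⟨h3, h4⟩ := Nat.pair_eq_pair.1 h2
         rw [h3, ih h4])

theorem toNat_surjective : Function.Surjective toNat := by
  intro n
  induction n using Nat.strong_induction_on with
  | _ n ih =>
    have key : ∀ q r, n = 13 * q + r → 0 < r →
        ∃ φ : MSOFormula, ∃ ψ χ : MSOFormula, φ.toNat = q ∧
          ψ.toNat = q.unpair.1 ∧ χ.toNat = q.unpair.2 := by
      intro q r h hr
      have h1 := Nat.unpair_left_le q
      have h2 := Nat.unpair_right_le q
      obtain ⟨φ, hφ⟩ := ih q (by omega)
      obtain ⟨ψ, hψ⟩ := ih q.unpair.1 (by omega)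
      obtain ⟨χ, hχ⟩ := ih q.unpair.2 (by omega)
      exact ⟨φ, ψ, χ, hφ, hψ, hχ⟩
    obtain ⟨q, r, hr, hn⟩ : ∃ q r, r < 13 ∧ n = 13 * q + r :=
      ⟨n / 13, n % 13, Nat.mod_lt _ (by norm_num), (Nat.div_add_mod n 13).symm⟩
    rcases Nat.eq_zero_or_pos r with rfl | hpos
    · exact ⟨eq q.unpair.1 q.unpair.2, by simp [toNat, hn]⟩
    · obtain ⟨φ, ψ, χ, hφ, hψ, hχ⟩ := key q r hn hpos
      interval_cases r
      · exact ⟨lt₁ q.unpair.1 q.unpair.2, by simp [toNat, hn]⟩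
      · exact ⟨lt₂ q.unpair.1 q.unpair.2, by simp [toNat, hn]⟩
      · exact ⟨mem q.unpair.1 q.unpair.2, by simp [toNat, hn]⟩
      · exact ⟨neg φ, by simp [toNat, hn, hφ]⟩
      · exact ⟨conj ψ χ, by simp [toNat, hn, hψ, hχ]⟩
      · exact ⟨disj ψ χ, by simp [toNat, hn, hψ, hχ]⟩
      · exact ⟨imp ψ χ, by simp [toNat, hn, hψ, hχ]⟩
      · exact ⟨iff ψ χ, by simp [toNat, hn, hψ, hχ]⟩
      · exact ⟨ex q.unpair.1 χ, by simp [toNat, hn, hχ]⟩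
      · exact ⟨all q.unpair.1 χ, by simp [toNat, hn, hχ]⟩
      · exact ⟨exSet q.unpair.1 χ, by simp [toNat, hn, hχ]⟩
      · exact ⟨allSet q.unpair.1 χ, by simp [toNat, hn, hχ]⟩

/-- The Gödel numbering as a bijection with `ℕ`. -/
noncomputable def equivNat : MSOFormula ≃ ℕ :=
  Equiv.ofBijective toNat ⟨toNat_injective, toNat_surjective⟩

/-- Computability of functions of formulas refers to the Gödel numbering `toNat`. -/
noncomputable instance instPrimcodable : Primcodable MSOFormula :=
  Primcodable.ofEquiv ℕ equivNat

end MSOFormula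

/-- The monadic second-order theory of a class of permutations: the sentences that hold in all its
members. -/
def msoTheory (C : Set FinPermutation) : Set MSOFormula :=
  {θ | θ.IsSentence ∧ ∀ π ∈ C, MSOFormula.Models π θ}

/-! ### Matrices as inputs of algorithms -/

/-- A matrix as explicit finite data: its dimensions and the list of its rows. -/
def matrixData {m n : ℕ} (M : Matrix (Fin m) (Fin n) SignType) : ℕ × ℕ × List (List ℤ) :=
  (m, n, List.ofFn fun i => List.ofFn fun j => (M i j : ℤ))

/-! ### Words and their orders -/

/-! Cut every row and column of the grid along its centre line into two half strips. On a diagonal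
segment a point has the same distance from the vertical as from the horizontal centre line of its
cell. List the points of a represented permutation by increasing distance, and record for each the
pair (half column, half row) that contains it. The resulting word determines both orders: different
half strips are compared by index, and inside one half strip a larger distance means further right
or up in an odd half, further left or down in an even half (`StripLt`). Conversely, every word over
the half cells that meet the figure comes from a permutation in the class. So a sentence lies in the
theory iff it holds in all such words (`mem_msoTheory_geomClass_iff`).

For words the argument is that of Büchi, Elgot and Trakhtenbrot. By induction on the formula,
satisfaction is recognized by a deterministic automaton (`recognizedBy_relSat`): products treat the
connectives and subset constructions the quantifiers. The number of states is bounded by an explicit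
function of the alphabet size and the Gödel number. Pumping the automaton of the negated sentence
turns any violating word into one no longer than that bound (`exists_short`,
`holdsInShortWords_iff`).

What remains is a finite search. Words and assignments are coded by numbers, all quantifiers become
bounded, and satisfaction is computed by course-of-values recursion (`primrecPred_codedSat`). The
automata serve only to justify the bound and are never constructed by the algorithm, which is
primitive recursive. -/

/-- The order of the points in positions `p` and `q` of a word, where the points lie in the strips
`c` and `c'`: strips are ordered by their indices, odd strips are filled increasingly and even
strips decreasingly. -/
def StripLt (c p c' q : ℕ) : Prop :=
  c < c' ∨ c = c' ∧ (c % 2 = 1 ∧ p < q ∨ c % 2 = 0 ∧ q < p)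

theorem stripLt_irrefl (c p : ℕ) : ¬ StripLt c p c p := by
  unfold StripLt; omega

/-- Only the relative order of the positions matters, so a finite automaton can compare strips with
the dummy positions `0` and `1` instead of storing positions. -/
theorem stripLt_of_lt {c p c' q : ℕ} (h : p < q) : StripLt c p c' q ↔ StripLt c 0 c' 1 := by
  unfold StripLt; omega

theorem stripLt_of_gt {c p c' q : ℕ} (h : q < p) : StripLt c p c' q ↔ StripLt c 1 c' 0 := by
  unfold StripLt; omega

/-! ### Semantics over an initial segment of the natural numbers -/

namespace MSOFormula

/-- Satisfaction over the universe `{0, …, n - 1}` with two binary relations; element variables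
are interpreted by sets, too. -/
def RelSat (R₁ R₂ : ℕ → ℕ → Prop) (n : ℕ) :
    MSOFormula → (ℕ → Set ℕ) → (ℕ → Set ℕ) → Prop
  | eq x y, v, _ => ∃ a < n, a ∈ v x ∧ a ∈ v y
  | lt₁ x y, v, _ => ∃ a < n, ∃ b < n, a ∈ v x ∧ b ∈ v y ∧ R₁ a b
  | lt₂ x y, v, _ => ∃ a < n, ∃ b < n, a ∈ v x ∧ b ∈ v y ∧ R₂ a b
  | mem x X, v, V => ∃ a < n, a ∈ v x ∧ a ∈ V X
  | neg φ, v, V => ¬ φ.RelSat R₁ R₂ n v V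
  | conj φ ψ, v, V => φ.RelSat R₁ R₂ n v V ∧ ψ.RelSat R₁ R₂ n v V
  | disj φ ψ, v, V => φ.RelSat R₁ R₂ n v V ∨ ψ.RelSat R₁ R₂ n v V
  | imp φ ψ, v, V => φ.RelSat R₁ R₂ n v V → ψ.RelSat R₁ R₂ n v V
  | iff φ ψ, v, V => (φ.RelSat R₁ R₂ n v V ↔ ψ.RelSat R₁ R₂ n v V)
  | ex x φ, v, V => ∃ a < n, φ.RelSat R₁ R₂ n (Function.update v x {a}) V
  | all x φ, v, V => ∀ a < n, φ.RelSat R₁ R₂ n (Function.update v x {a}) V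
  | exSet X φ, v, V => ∃ A : Set ℕ, φ.RelSat R₁ R₂ n v (Function.update V X A)
  | allSet X φ, v, V => ∀ A : Set ℕ, φ.RelSat R₁ R₂ n v (Function.update V X A)

end MSOFormula

/-! ### Recognizability with a bounded number of states -/

/-- A property of words with marked positions is recognized by a deterministic automaton with at
most `s` states. -/
def RecognizedBy {A : Type} (s : ℕ)
    (P : (ℕ → A) → (ℕ → Set ℕ) → (ℕ → Set ℕ) → ℕ → Prop) : Prop :=
  ∃ (Q : Type) (_ : Fintype Q) (st : (ℕ → A) → (ℕ → Set ℕ) → (ℕ → Set ℕ) → ℕ → Q)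
    (q₀ : Q) (δ : Q → A → (ℕ → Prop) → (ℕ → Prop) → Q) (F : Set Q), Fintype.card Q ≤ s ∧
    (∀ g v V, st g v V 0 = q₀) ∧
    (∀ g v V n, st g v V (n + 1) = δ (st g v V n) (g n) (fun x => n ∈ v x) fun X => n ∈ V X) ∧
    ∀ g v V n, P g v V n ↔ st g v V n ∈ F

namespace RecognizedBy

variable {A : Type} {s t : ℕ} {P P' : (ℕ → A) → (ℕ → Set ℕ) → (ℕ → Set ℕ) → ℕ → Prop}

theorem mono (h : RecognizedBy s P) (hst : s ≤ t) : RecognizedBy t P := by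
  obtain ⟨Q, i, st, q₀, δ, F, hc, h⟩ := h
  exact ⟨Q, i, st, q₀, δ, F, hc.trans hst, h⟩

theorem of_iff (h : RecognizedBy s P) (hP : ∀ g v V n, P' g v V n ↔ P g v V n) :
    RecognizedBy s P' := by
  obtain ⟨Q, i, st, q₀, δ, F, hc, h0, h1, h2⟩ := h
  exact ⟨Q, i, st, q₀, δ, F, hc, h0, h1, fun g v V n => (hP g v V n).trans (h2 g v V n)⟩

theorem not (h : RecognizedBy s P) : RecognizedBy s fun g v V n => ¬ P g v V n := by
  obtain ⟨Q, i, st, q₀, δ, F, hc, h0, h1, h2⟩ := h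
  exact ⟨Q, i, st, q₀, δ, Fᶜ, hc, h0, h1, fun g v V n => not_congr (h2 g v V n)⟩

/-- The product automaton. -/
theorem binary (op : Prop → Prop → Prop) (h : RecognizedBy s P) (h' : RecognizedBy t P') :
    RecognizedBy (s * t) fun g v V n => op (P g v V n) (P' g v V n) := by
  obtain ⟨Q, i, st, q₀, δ, F, hc, h0, h1, h2⟩ := h
  obtain ⟨Q', i', st', q₀', δ', F', hc', h0', h1', h2'⟩ := h'
  refine ⟨Q × Q', inferInstance, fun g v V n => (st g v V n, st' g v V n), (q₀, q₀'),
    fun q a x X => (δ q.1 a x X, δ' q.2 a x X), {q | op (q.1 ∈ F) (q.2 ∈ F')}, ?_, ?_, ?_, ?_⟩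
  · rw [Fintype.card_prod]; exact Nat.mul_le_mul hc hc'
  · intro g v V; simp only [h0, h0']
  · intro g v V n; simp only [h1, h1']
  · intro g v V n; simp only [h2, h2', Set.mem_ofPred_eq]

/-- The states of a deterministic automaton do not depend on the future of the word. -/
theorem state_congr {Q : Type} {st : (ℕ → A) → (ℕ → Set ℕ) → (ℕ → Set ℕ) → ℕ → Q}
    {q₀ : Q} {δ : Q → A → (ℕ → Prop) → (ℕ → Prop) → Q} (h0 : ∀ g v V, st g v V 0 = q₀)
    (h1 : ∀ g v V n,
      st g v V (n + 1) = δ (st g v V n) (g n) (fun x => n ∈ v x) fun X => n ∈ V X)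
    {g : ℕ → A} {v v' V V' : ℕ → Set ℕ} {n : ℕ} (hv : ∀ k < n, ∀ x, k ∈ v x ↔ k ∈ v' x)
    (hV : ∀ k < n, ∀ x, k ∈ V x ↔ k ∈ V' x) : st g v V n = st g v' V' n := by
  induction n with
  | zero => rw [h0, h0]
  | succ n ih =>
    rw [h1, h1, ih (fun k hk => hv k (by omega)) (fun k hk => hV k (by omega))]
    congr 1
    · funext x; exact propext (hv n (by omega) x)
    · funext x; exact propext (hV n (by omega) x)

/-- Changing the value of one variable changes, at each position, just one of the marks that the
automaton reads there. -/
theorem mem_update {v : ℕ → Set ℕ} {x y k : ℕ} {B : Set ℕ} :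
    k ∈ Function.update v x B y ↔ Function.update (fun z => k ∈ v z) x (k ∈ B) y := by
  by_cases h : y = x
  · subst h; simp
  · simp [h]

/-- The subset automaton, guessing a set of positions. -/
theorem exSet (X : ℕ) (h : RecognizedBy s P) :
    RecognizedBy (2 ^ s) fun g v V n => ∃ B, P g v (Function.update V X B) n := by
  classical
  obtain ⟨Q, i, st, q₀, δ, F, hc, h0, h1, h2⟩ := h
  refine ⟨Set Q, inferInstance, fun g v V n => {q | ∃ B, q = st g v (Function.update V X B) n},
    {q₀}, fun S a y Y => {q | ∃ q' ∈ S, ∃ b : Prop, q = δ q' a y (Function.update Y X b)},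
    {S | ∃ q ∈ S, q ∈ F}, ?_, ?_, ?_, ?_⟩
  · rw [Fintype.card_set]; exact Nat.pow_le_pow_right (by norm_num) hc
  · intro g v V; ext q; simp [h0]
  · intro g v V n
    ext q
    constructor
    · rintro ⟨B, rfl⟩
      refine ⟨_, ⟨B, rfl⟩, n ∈ B, ?_⟩
      rw [h1]
      congr 1
      funext Y; exact propext mem_update
    · rintro ⟨_, ⟨B, rfl⟩, b, rfl⟩
      -- The guess `b` at position `n` is added to what `B` says earlier; by `state_congr` the state
      -- before `n` is unaffected.
      refine ⟨{k | k < n ∧ k ∈ B ∨ k = n ∧ b}, ?_⟩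
      rw [h1]
      congr 1
      · refine state_congr h0 h1 (fun _ _ _ => Iff.rfl) fun k hk Y => ?_
        have : k ≠ n := by omega
        simp [mem_update, hk, this]
      · funext Y
        simp [mem_update]
  · intro g v V n
    simp only [h2, Set.mem_ofPred_eq]
    constructor
    · rintro ⟨B, hB⟩; exact ⟨_, ⟨B, rfl⟩, hB⟩
    · rintro ⟨_, ⟨B, rfl⟩, hB⟩; exact ⟨B, hB⟩

/-- The subset automaton, guessing a single position. -/
theorem ex (x : ℕ) (h : RecognizedBy s P) :
    RecognizedBy (2 ^ (s * 2)) fun g v V n => ∃ a < n, P g (Function.update v x {a}) V n := by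
  classical
  obtain ⟨Q, i, st, q₀, δ, F, hc, h0, h1, h2⟩ := h
  -- The Boolean tells whether the position has been guessed already; until then the run is that of
  -- the empty set.
  refine ⟨Set (Q × Bool), inferInstance, fun g v V n =>
    {q | q = (st g (Function.update v x ∅) V n, false) ∨
      ∃ a < n, q = (st g (Function.update v x {a}) V n, true)},
    {(q₀, false)}, fun S l y Y =>
      {q | (∃ q' ∈ S, q = (δ q'.1 l (Function.update y x False) Y, q'.2)) ∨
        ∃ q' ∈ S, q'.2 = false ∧ q = (δ q'.1 l (Function.update y x True) Y, true)},
    {S | ∃ q ∈ S, q.1 ∈ F ∧ q.2 = true}, ?_, ?_, ?_, ?_⟩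
  · rw [Fintype.card_set, Fintype.card_prod, Fintype.card_bool]
    exact Nat.pow_le_pow_right (by norm_num) (Nat.mul_le_mul_right 2 hc)
  · intro g v V; ext q; simp [h0]
  · intro g v V n
    have e0 : st g (Function.update v x ∅) V (n + 1) =
        δ (st g (Function.update v x ∅) V n) (g n)
          (Function.update (fun z => n ∈ v z) x False) fun X => n ∈ V X := by
      rw [h1]; congr 1; funext y; exact propext (by simp [mem_update])
    have e1 : ∀ a < n, st g (Function.update v x {a}) V (n + 1) =
        δ (st g (Function.update v x {a}) V n) (g n)
          (Function.update (fun z => n ∈ v z) x False) fun X => n ∈ V X := by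
      intro a ha
      have : n ≠ a := by omega
      rw [h1]; congr 1; funext y; exact propext (by simp [mem_update, this])
    have e2 : st g (Function.update v x {n}) V (n + 1) =
        δ (st g (Function.update v x ∅) V n) (g n)
          (Function.update (fun z => n ∈ v z) x True) fun X => n ∈ V X := by
      rw [h1]
      congr 1
      · refine state_congr h0 h1 (fun k hk y => ?_) (fun _ _ _ => Iff.rfl)
        have : k ≠ n := by omega
        simp [mem_update, this]
      · funext y; exact propext (by simp [mem_update])
    ext q
    constructor
    · rintro (rfl | ⟨a, ha, rfl⟩)
      · exact Or.inl ⟨_, Or.inl rfl, by rw [e0]⟩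
      · rcases Nat.lt_succ_iff_lt_or_eq.1 ha with ha | rfl
        · exact Or.inl ⟨_, Or.inr ⟨a, ha, rfl⟩, by rw [e1 a ha]⟩
        · exact Or.inr ⟨_, Or.inl rfl, rfl, by rw [e2]⟩
    · rintro (⟨_, rfl | ⟨a, ha, rfl⟩, rfl⟩ | ⟨_, rfl | ⟨a, ha, rfl⟩, hb, rfl⟩)
      · exact Or.inl (by rw [e0])
      · exact Or.inr ⟨a, by omega, by rw [e1 a ha]⟩
      · exact Or.inr ⟨n, by omega, by rw [e2]⟩
      · cases hb
  · intro g v V n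
    simp only [h2, Set.mem_ofPred_eq]
    constructor
    · rintro ⟨a, ha, hF⟩; exact ⟨_, Or.inr ⟨a, ha, rfl⟩, hF, rfl⟩
    · rintro ⟨_, rfl | ⟨a, ha, rfl⟩, hF, hb⟩
      · cases hb
      · exact ⟨a, ha, hF⟩

/-- A two-state automaton looking for a position of a certain kind. -/
theorem exists_lt (c : (ℕ → Prop) → (ℕ → Prop) → Prop) :
    RecognizedBy 2 fun (_ : ℕ → A) v V n => ∃ a < n, c (fun x => a ∈ v x) fun X => a ∈ V X := by
  refine ⟨Prop, inferInstance, fun _ v V n => ∃ a < n, c (fun x => a ∈ v x) fun X => a ∈ V X,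
    False, fun q _ y Y => q ∨ c y Y, {q | q}, by simp, ?_, ?_, ?_⟩
  · simp
  · intro g v V n; simp only [Nat.exists_lt_succ_right]
  · intro g v V n; rfl

/-- An automaton comparing two positions in the order given by the strips of the letters. -/
theorem stripLt [Fintype A] (κ : A → ℕ) (x y : ℕ) :
    RecognizedBy (2 ^ (2 * Fintype.card A + 1)) fun (g : ℕ → A) v _ n =>
      ∃ a < n, ∃ b < n, a ∈ v x ∧ b ∈ v y ∧ StripLt (κ (g a)) a (κ (g b)) b := by
  classical
  -- A state stores the letters seen so far at positions marked by `x`, those at positions marked by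
  -- `y`, and whether a suitable pair has occurred.
  refine ⟨Set A × Set A × Prop, inferInstance, fun g v V n =>
    ({l | ∃ a < n, a ∈ v x ∧ g a = l}, {l | ∃ a < n, a ∈ v y ∧ g a = l},
      ∃ a < n, ∃ b < n, a ∈ v x ∧ b ∈ v y ∧ StripLt (κ (g a)) a (κ (g b)) b),
    (∅, ∅, False), fun q l z _ => ({l' | l' ∈ q.1 ∨ z x ∧ l = l'}, {l' | l' ∈ q.2.1 ∨ z y ∧ l = l'},
      q.2.2 ∨ (z y ∧ ∃ l' ∈ q.1, StripLt (κ l') 0 (κ l) 1) ∨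
        (z x ∧ ∃ l' ∈ q.2.1, StripLt (κ l) 1 (κ l') 0)),
    {q | q.2.2}, ?_, ?_, ?_, ?_⟩
  · simp only [Fintype.card_prod, Fintype.card_set, Fintype.card_prop]
    apply le_of_eq; ring
  · intro g v V; simp
  · intro g v V n
    refine Prod.ext ?_ (Prod.ext ?_ (propext ?_))
    · ext l; simp only [Set.mem_ofPred_eq, Nat.exists_lt_succ_right]
    · ext l; simp only [Set.mem_ofPred_eq, Nat.exists_lt_succ_right]
    · simp only [Set.mem_ofPred_eq]
      constructor
      · rintro ⟨a, ha, b, hb, hx, hy, hab⟩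
        rcases Nat.lt_succ_iff_lt_or_eq.1 ha with ha | rfl <;>
          rcases Nat.lt_succ_iff_lt_or_eq.1 hb with hb | rfl
        · exact Or.inl ⟨a, ha, b, hb, hx, hy, hab⟩
        · exact Or.inr (Or.inl ⟨hy, _, ⟨a, ha, hx, rfl⟩, (stripLt_of_lt ha).1 hab⟩)
        · exact Or.inr (Or.inr ⟨hx, _, ⟨b, hb, hy, rfl⟩, (stripLt_of_gt hb).1 hab⟩)
        · exact absurd hab (stripLt_irrefl _ _)
      · rintro (⟨a, ha, b, hb, h⟩ | ⟨hy, _, ⟨a, ha, hx, rfl⟩, h⟩ | ⟨hx, _, ⟨b, hb, hy, rfl⟩, h⟩)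
        · exact ⟨a, by omega, b, by omega, h⟩
        · exact ⟨a, by omega, n, by omega, hx, hy, (stripLt_of_lt ha).2 h⟩
        · exact ⟨n, by omega, b, by omega, hx, hy, (stripLt_of_gt hb).2 h⟩
  · intro g v V n; rfl

/-- Pumping: a word with a recognized property can be shortened. -/
theorem exists_short (h : RecognizedBy s P) {g : ℕ → A} {n : ℕ}
    (hP : P g (fun _ => ∅) (fun _ => ∅) n) :
    ∃ (g' : ℕ → A) (n' : ℕ), n' ≤ s ∧ (∀ k < n', ∃ k' < n, g' k = g k') ∧
      P g' (fun _ => ∅) (fun _ => ∅) n' := by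
  obtain ⟨Q, i, st, q₀, δ, F, hc, h0, h1, h2⟩ := h
  induction n using Nat.strong_induction_on generalizing g with
  | _ n ih =>
    rcases le_or_gt n s with hn | hn
    · exact ⟨g, n, hn, fun k hk => ⟨k, hk, rfl⟩, hP⟩
    · obtain ⟨a, b, hab, hst⟩ := Fintype.exists_ne_map_eq_of_card_lt
        (fun k : Fin n => st g (fun _ => ∅) (fun _ => ∅) k)
        (by rw [Fintype.card_fin]; exact hc.trans_lt hn)
      wlog hlt : a < b generalizing a b
      · exact this b a hab.symm hst.symm (lt_of_le_of_ne (not_lt.1 hlt) hab.symm)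
      obtain ⟨a, ha⟩ := a
      obtain ⟨b, hb⟩ := b
      replace hlt : a < b := hlt
      replace hst : st g (fun _ => ∅) (fun _ => ∅) a = st g (fun _ => ∅) (fun _ => ∅) b := hst
      -- Delete the positions from `a` to `b - 1`. The states before `a` and before `b` coincide, so
      -- the run on the remainder, and with it acceptance, is unchanged.
      let g' : ℕ → A := fun k => if k < a then g k else g (k + (b - a))
      have e1 : ∀ k ≤ a, st g' (fun _ => ∅) (fun _ => ∅) k = st g (fun _ => ∅) (fun _ => ∅) k := by
        intro k hk
        induction k with
        | zero => rw [h0, h0]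
        | succ k ihk => rw [h1, h1, ihk (by omega), show g' k = g k from if_pos (by omega)]
      have e2 : ∀ k, st g' (fun _ => ∅) (fun _ => ∅) (a + k) =
          st g (fun _ => ∅) (fun _ => ∅) (b + k) := by
        intro k
        induction k with
        | zero => exact (e1 a le_rfl).trans hst
        | succ k ihk =>
          rw [← add_assoc, ← add_assoc, h1, h1, ihk,
            show g' (a + k) = g (b + k) from (if_neg (by omega)).trans (congrArg g (by omega))]
          rfl
      obtain ⟨g'', n'', hn'', hk, hP''⟩ := ih (n - (b - a)) (by omega) (g := g') (by
        rw [h2, show n - (b - a) = a + (n - b) by omega, e2, show b + (n - b) = n by omega, ← h2]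
        exact hP)
      refine ⟨g'', n'', hn'', fun k hk' => ?_, hP''⟩
      obtain ⟨k', hk'', e⟩ := hk k hk'
      rw [e]
      by_cases hka : k' < a
      · exact ⟨k', by omega, if_pos hka⟩
      · exact ⟨k' + (b - a), by omega, if_neg hka⟩

end RecognizedBy

/-! ### Growth of the number of states -/

/-- The number of states that suffice for formulas with Gödel number at most `c`, over an alphabet
with `L` letters. -/
def stateBound (L : ℕ) (c : ℕ) : ℕ :=
  Nat.rec (2 ^ (2 * L + 1)) (fun _ s => 2 ^ (s * s * 2)) c

/-- The start value is the size of the automaton comparing two positions. One step dominates every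
construction used: the product with `s * s` states and the subset automata with `2 ^ s` and `2 ^ (s
* 2)` states. -/
theorem stateBound_succ (L c : ℕ) :
    stateBound L (c + 1) = 2 ^ (stateBound L c * stateBound L c * 2) := rfl

theorem mul_self_le_stateBound_succ (L c : ℕ) :
    stateBound L c * stateBound L c * 2 ≤ stateBound L (c + 1) :=
  Nat.lt_two_pow_self.le

theorem stateBound_pos (L c : ℕ) : 0 < stateBound L c := by
  cases c <;> simp [stateBound]

theorem stateBound_mono (L : ℕ) : Monotone (stateBound L) :=
  monotone_nat_of_le_succ fun c => by
    have := mul_self_le_stateBound_succ L c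
    nlinarith [stateBound_pos L c]

theorem two_pow_stateBound_le {L c d : ℕ} (h : c < d) :
    2 ^ (stateBound L c * 2) ≤ stateBound L d := by
  refine le_trans ?_ (stateBound_mono L (Nat.succ_le_of_lt h))
  rw [stateBound_succ]
  exact Nat.pow_le_pow_right (by norm_num) (by nlinarith [stateBound_pos L c])

theorem stateBound_mul_le {L c c' d : ℕ} (h : c < d) (h' : c' < d) :
    stateBound L c * stateBound L c' ≤ stateBound L d := by
  obtain ⟨d, rfl⟩ := Nat.exists_eq_succ_of_ne_zero (by omega : d ≠ 0)
  have h1 := stateBound_mono L (Nat.lt_succ_iff.1 h)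
  have h2 := stateBound_mono L (Nat.lt_succ_iff.1 h')
  have := mul_self_le_stateBound_succ L d
  have := Nat.mul_le_mul h1 h2
  rw [Nat.succ_eq_add_one]
  omega

theorem le_stateBound (L c : ℕ) : 2 ^ (2 * L + 1) ≤ stateBound L c :=
  stateBound_mono L (Nat.zero_le c)

theorem two_le_stateBound (L c : ℕ) : 2 ≤ stateBound L c :=
  le_trans (Nat.le_self_pow (by omega) 2) (le_stateBound L c)

namespace MSOFormula

/-- Each connective or quantifier costs at most one step of `stateBound`, and the Gödel number of a
formula exceeds those of its immediate subformulas, so it can serve as the step count. Universal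
quantifiers are treated as negated existential ones. -/
theorem recognizedBy_relSat {A : Type} [Fintype A] (κ₁ κ₂ : A → ℕ) (φ : MSOFormula) :
    RecognizedBy (stateBound (Fintype.card A) φ.toNat) fun (g : ℕ → A) v V n =>
      φ.RelSat (fun a b => StripLt (κ₁ (g a)) a (κ₁ (g b)) b)
        (fun a b => StripLt (κ₂ (g a)) a (κ₂ (g b)) b) n v V := by
  have pl := Nat.left_le_pair
  have pr := Nat.right_le_pair
  induction φ with
  | eq x y => exact (RecognizedBy.exists_lt fun z _ => z x ∧ z y).mono (two_le_stateBound _ _)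
  | mem x X => exact (RecognizedBy.exists_lt fun z Z => z x ∧ Z X).mono (two_le_stateBound _ _)
  | lt₁ x y => exact (RecognizedBy.stripLt κ₁ x y).mono (le_stateBound _ _)
  | lt₂ x y => exact (RecognizedBy.stripLt κ₂ x y).mono (le_stateBound _ _)
  | neg φ ih => exact ih.not.mono (stateBound_mono _ (by simp only [toNat]; omega))
  | conj φ ψ h h' =>
    have := pl φ.toNat ψ.toNat
    have := pr φ.toNat ψ.toNat
    exact (h.binary And h').mono (stateBound_mul_le (by simp only [toNat]; omega)
      (by simp only [toNat]; omega))
  | disj φ ψ h h' =>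
    have := pl φ.toNat ψ.toNat
    have := pr φ.toNat ψ.toNat
    exact (h.binary Or h').mono (stateBound_mul_le (by simp only [toNat]; omega)
      (by simp only [toNat]; omega))
  | imp φ ψ h h' =>
    have := pl φ.toNat ψ.toNat
    have := pr φ.toNat ψ.toNat
    exact (h.binary (fun p q => p → q) h').mono (stateBound_mul_le (by simp only [toNat]; omega)
      (by simp only [toNat]; omega))
  | iff φ ψ h h' =>
    have := pl φ.toNat ψ.toNat
    have := pr φ.toNat ψ.toNat
    exact (h.binary Iff h').mono (stateBound_mul_le (by simp only [toNat]; omega)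
      (by simp only [toNat]; omega))
  | ex x φ ih =>
    have := pr x φ.toNat
    exact (ih.ex x).mono (two_pow_stateBound_le (by simp only [toNat]; omega))
  | all x φ ih =>
    have := pr x φ.toNat
    exact ((ih.not.ex x).not.of_iff fun g v V n => by simp [RelSat]).mono
      (two_pow_stateBound_le (by simp only [toNat]; omega))
  | exSet X φ ih =>
    have := pr X φ.toNat
    exact (ih.exSet X).mono ((Nat.pow_le_pow_right (by norm_num) (by omega)).trans
      (two_pow_stateBound_le (L := Fintype.card A) (c := φ.toNat) (by simp only [toNat]; omega)))
  | allSet X φ ih =>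
    have := pr X φ.toNat
    exact ((ih.not.exSet X).not.of_iff fun g v V n => by simp [RelSat]).mono
      ((Nat.pow_le_pow_right (by norm_num) (by omega)).trans
      (two_pow_stateBound_le (L := Fintype.card A) (c := φ.toNat) (by simp only [toNat]; omega)))

end MSOFormula

/-! ### Permutations as words -/

namespace MSOFormula

/-- Inside the universe, a partial element assignment corresponds to a set with at most one element,
an undefined value to the empty set; this matches the existential reading of atomic formulas on both
sides. -/
theorem sat_iff_relSat {π : FinPermutation} {n : ℕ} (e : π.carrier ≃ Fin n)
    {R₁ R₂ : ℕ → ℕ → Prop} (h₁ : ∀ a b, π.lt₁ a b ↔ R₁ (e a) (e b))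
    (h₂ : ∀ a b, π.lt₂ a b ↔ R₂ (e a) (e b)) (φ : MSOFormula) {v : ℕ → Option π.carrier}
    {V : ℕ → Set π.carrier} {v' V' : ℕ → Set ℕ} (hv : ∀ x a, (e a : ℕ) ∈ v' x ↔ v x = some a)
    (hV : ∀ X a, (e a : ℕ) ∈ V' X ↔ a ∈ V X) :
    φ.Sat π v V ↔ φ.RelSat R₁ R₂ n v' V' := by
  have exE : ∀ p : ℕ → Prop, (∃ a < n, p a) ↔ ∃ a : π.carrier, p (e a) := fun p =>
    ⟨fun ⟨a, ha, h⟩ => ⟨e.symm ⟨a, ha⟩, by simpa using h⟩, fun ⟨a, h⟩ => ⟨e a, (e a).2, h⟩⟩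
  have allE : ∀ p : ℕ → Prop, (∀ a < n, p a) ↔ ∀ a : π.carrier, p (e a) := fun p =>
    ⟨fun h a => h _ (e a).2, fun h a ha => by simpa using h (e.symm ⟨a, ha⟩)⟩
  have upd : ∀ {v : ℕ → Option π.carrier} {v' : ℕ → Set ℕ},
      (∀ x a, (e a : ℕ) ∈ v' x ↔ v x = some a) → ∀ (x : ℕ) (b : π.carrier) (y : ℕ) a,
      (e a : ℕ) ∈ Function.update v' x {(e b : ℕ)} y ↔
        Function.update v x (some b) y = some a := by
    intro v v' hv x b y a
    by_cases hy : y = x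
    · subst hy
      simp only [Function.update_self, Set.mem_singleton_iff, Option.some.injEq, Fin.val_inj,
        e.injective.eq_iff, eq_comm]
    · simp only [Function.update_of_ne hy, hv]
  have upd2 : ∀ {V : ℕ → Set π.carrier} {V' : ℕ → Set ℕ},
      (∀ x a, (e a : ℕ) ∈ V' x ↔ a ∈ V x) → ∀ (x : ℕ) (B : Set π.carrier) (B' : Set ℕ),
      (∀ a, (e a : ℕ) ∈ B' ↔ a ∈ B) → ∀ (y : ℕ) a,
      (e a : ℕ) ∈ Function.update V' x B' y ↔ a ∈ Function.update V x B y := by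
    intro V V' hV x B B' hB y a
    by_cases hy : y = x
    · subst hy; simpa using hB a
    · simp only [Function.update_of_ne hy, hV]
  have im : ∀ (B : Set π.carrier) a, (e a : ℕ) ∈ {k | ∃ b ∈ B, (e b : ℕ) = k} ↔ a ∈ B := by
    intro B a
    simp [Fin.val_inj]
  induction φ generalizing v V v' V' with
  | eq x y => simp [Sat, RelSat, exE, hv]
  | lt₁ x y => simp only [Sat, RelSat, exE, hv, h₁]
  | lt₂ x y => simp only [Sat, RelSat, exE, hv, h₂]
  | mem x X => simp only [Sat, RelSat, exE, hv, hV]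
  | neg φ ih => exact not_congr (ih hv hV)
  | conj φ ψ h h' => exact and_congr (h hv hV) (h' hv hV)
  | disj φ ψ h h' => exact or_congr (h hv hV) (h' hv hV)
  | imp φ ψ h h' => exact imp_congr (h hv hV) (h' hv hV)
  | iff φ ψ h h' => exact iff_congr (h hv hV) (h' hv hV)
  | ex x φ ih =>
    simp only [Sat, RelSat, exE]
    exact exists_congr fun a => ih (upd hv x a) hV
  | all x φ ih =>
    simp only [Sat, RelSat, allE]
    exact forall_congr' fun a => ih (upd hv x a) hV
  | exSet X φ ih =>
    simp only [Sat, RelSat]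
    constructor
    · rintro ⟨B, hB⟩; exact ⟨_, (ih hv (upd2 hV X B _ (im B))).1 hB⟩
    · rintro ⟨B, hB⟩
      exact ⟨{a | (e a : ℕ) ∈ B}, (ih hv (upd2 hV X _ B fun _ => Iff.rfl)).2 hB⟩
  | allSet X φ ih =>
    simp only [Sat, RelSat]
    constructor
    · intro h B
      exact (ih hv (upd2 hV X {a | (e a : ℕ) ∈ B} B fun _ => Iff.rfl)).1 (h _)
    · intro h B; exact (ih hv (upd2 hV X B _ (im B))).2 (h _)

theorem models_iff_relSat {π : FinPermutation} {n : ℕ} (e : π.carrier ≃ Fin n)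
    {R₁ R₂ : ℕ → ℕ → Prop} (h₁ : ∀ a b, π.lt₁ a b ↔ R₁ (e a) (e b))
    (h₂ : ∀ a b, π.lt₂ a b ↔ R₂ (e a) (e b)) (φ : MSOFormula) :
    Models π φ ↔ φ.RelSat R₁ R₂ n (fun _ => ∅) fun _ => ∅ :=
  sat_iff_relSat e h₁ h₂ φ (by simp) (by simp)

end MSOFormula

/-! ### Points on the figure versus words over the half cells -/

/-- The half strip containing the point at offset `t` in the strip `j`. -/
def IsHalf (j : ℕ) (t : ℝ) (c : ℕ) : Prop :=
  c = 2 * j ∧ t ≤ 1 / 2 ∨ c = 2 * j + 1 ∧ 1 / 2 ≤ t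

/-- Here `p` and `q` are places in a list sorted by distance from the centre lines. Within a half
strip that distance determines the coordinate; ties in it are harmless, since they then mean equal
coordinates, which `heq` covers. -/
theorem add_lt_add_of_stripLt {j j' : ℕ} {t t' : ℝ} {c c' p q : ℕ} (ht : 0 < t ∧ t < 1)
    (ht' : 0 < t' ∧ t' < 1) (hc : IsHalf j t c) (hc' : IsHalf j' t' c')
    (hpq : |t - 1 / 2| < |t' - 1 / 2| → p < q) (hqp : |t' - 1 / 2| < |t - 1 / 2| → q < p)
    (heq : (j : ℝ) + t = j' + t' → c = c' ∧ p = q) (h : StripLt c p c' q) :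
    (j : ℝ) + t < j' + t' := by
  by_contra hlt
  have hle : (j' : ℝ) + t' ≤ j + t := not_lt.1 hlt
  rcases hle.eq_or_lt with he | hlt'
  · obtain ⟨rfl, rfl⟩ := heq he.symm
    exact stripLt_irrefl _ _ h
  have hj : j' ≤ j := by
    by_contra hj
    have : (j : ℝ) + 1 ≤ j' := by exact_mod_cast not_le.1 hj
    linarith
  rcases hj.eq_or_lt with rfl | hj
  · have hlt2 : t' < t := by linarith
    unfold StripLt at h
    rcases hc with ⟨rfl, h1⟩ | ⟨rfl, h1⟩ <;> rcases hc' with ⟨rfl, h2⟩ | ⟨rfl, h2⟩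
    · rw [abs_of_nonpos (by linarith), abs_of_nonpos (by linarith)] at hpq
      have := hpq (by linarith)
      omega
    · linarith
    · omega
    · rw [abs_of_nonneg (by linarith), abs_of_nonneg (by linarith)] at hqp
      have := hqp (by linarith)
      omega
  · unfold StripLt at h
    rcases hc with ⟨rfl, h1⟩ | ⟨rfl, h1⟩ <;> rcases hc' with ⟨rfl, h2⟩ | ⟨rfl, h2⟩ <;> omega

theorem stripLt_trichotomy (c p c' q : ℕ) :
    StripLt c p c' q ∨ (c = c' ∧ p = q) ∨ StripLt c' q c p := by
  unfold StripLt; omega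

/-- The converse follows by trichotomy: in the remaining cases the coordinates would be equal or, by
the implication for the swapped pair, reversed. -/
theorem add_lt_add_iff_stripLt {j j' : ℕ} {t t' : ℝ} {c c' p q : ℕ} (ht : 0 < t ∧ t < 1)
    (ht' : 0 < t' ∧ t' < 1) (hc : IsHalf j t c) (hc' : IsHalf j' t' c')
    (hpq : |t - 1 / 2| < |t' - 1 / 2| → p < q) (hqp : |t' - 1 / 2| < |t - 1 / 2| → q < p)
    (heq : (j : ℝ) + t = j' + t' ↔ c = c' ∧ p = q) :
    (j : ℝ) + t < j' + t' ↔ StripLt c p c' q := by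
  refine ⟨fun h => ?_, add_lt_add_of_stripLt ht ht' hc hc' hpq hqp heq.1⟩
  rcases stripLt_trichotomy c p c' q with h1 | h1 | h1
  · exact h1
  · exact absurd (heq.2 h1) h.ne
  · refine absurd (add_lt_add_of_stripLt ht' ht hc' hc hqp hpq (fun e => ?_) h1) h.not_gt
    exact ⟨(heq.1 e.symm).1.symm, (heq.1 e.symm).2.symm⟩

/-- The entry of a matrix, given as a list of rows, in the cell containing a given pair of a half
column and a half row, where rows are counted from the bottom. -/
def halfCellEntry (m : ℕ) (rows : List (List ℤ)) (c r : ℕ) : ℤ :=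
  (rows.getD (m - 1 - r / 2) []).getD (c / 2) 0

/-- The pair of a half column and a half row coded by `l` meets the standard figure. -/
def IsLetter (D : ℕ × ℕ × List (List ℤ)) (l : ℕ) : Prop :=
  l.unpair.1 < 2 * D.2.1 ∧ l.unpair.2 < 2 * D.1 ∧
    (halfCellEntry D.1 D.2.2 l.unpair.1 l.unpair.2 = 1 ∧ l.unpair.1 % 2 = l.unpair.2 % 2 ∨
      halfCellEntry D.1 D.2.2 l.unpair.1 l.unpair.2 = -1 ∧ l.unpair.1 % 2 ≠ l.unpair.2 % 2)

/-- A rising diagonal meets the half cells left-bottom and right-top, hence equal parities; a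
falling one meets the other two. Half rows are counted from the bottom but matrix rows from the top,
whence `m - 1 - i`. The index bounds keep list lookups in range, so default values play no role. -/
theorem isLetter_matrixData_iff {m n : ℕ} (M : Matrix (Fin m) (Fin n) SignType) (l : ℕ) :
    IsLetter (matrixData M) l ↔ ∃ (i : Fin m) (j : Fin n), l.unpair.1 / 2 = j ∧
      (l.unpair.2 / 2 : ℕ) = m - 1 - i ∧
      (M i j = 1 ∧ l.unpair.1 % 2 = l.unpair.2 % 2 ∨
        M i j = -1 ∧ l.unpair.1 % 2 ≠ l.unpair.2 % 2) := by
  have entry : ∀ (i : Fin m) (j : Fin n), l.unpair.1 / 2 = j →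
      (l.unpair.2 / 2 : ℕ) = m - 1 - i →
      halfCellEntry m (matrixData M).2.2 l.unpair.1 l.unpair.2 = (M i j : ℤ) := by
    intro i j hj hi
    have h : m - 1 - l.unpair.2 / 2 = i := by omega
    simp only [halfCellEntry, matrixData, h, hj]
    simp [List.getD_eq_getElem?_getD]
  have sgn : ∀ s : SignType, ((s : ℤ) = 1 ↔ s = 1) ∧ ((s : ℤ) = -1 ↔ s = -1) := by decide
  constructor
  · rintro ⟨hc, hr, h⟩
    replace hc : l.unpair.1 < 2 * n := hc
    replace hr : l.unpair.2 < 2 * m := hr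
    refine ⟨⟨m - 1 - l.unpair.2 / 2, by omega⟩, ⟨l.unpair.1 / 2, by omega⟩, rfl,
      by simp only; omega, ?_⟩
    have e := entry ⟨m - 1 - l.unpair.2 / 2, by omega⟩ ⟨l.unpair.1 / 2, by omega⟩ rfl
      (by simp only; omega)
    change halfCellEntry m (matrixData M).2.2 l.unpair.1 l.unpair.2 = 1 ∧ _ ∨
      halfCellEntry m (matrixData M).2.2 l.unpair.1 l.unpair.2 = -1 ∧ _ at h
    rw [e, (sgn _).1, (sgn _).2] at h
    exact h
  · rintro ⟨i, j, hj, hi, h⟩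
    have e := entry i j hj hi
    refine ⟨show l.unpair.1 < 2 * n by omega, show l.unpair.2 < 2 * m by omega, ?_⟩
    change halfCellEntry m (matrixData M).2.2 l.unpair.1 l.unpair.2 = 1 ∧ _ ∨
      halfCellEntry m (matrixData M).2.2 l.unpair.1 l.unpair.2 = -1 ∧ _
    rw [e, (sgn _).1, (sgn _).2]
    exact h

/-- The order on the positions of a word given by the half columns. -/
def wordLt₁ (g : ℕ → ℕ) (p q : ℕ) : Prop := StripLt (g p).unpair.1 p (g q).unpair.1 q

/-- The order on the positions of a word given by the half rows. -/
def wordLt₂ (g : ℕ → ℕ) (p q : ℕ) : Prop := StripLt (g p).unpair.2 p (g q).unpair.2 q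

/-- An enumeration of a finite type along which a real-valued function increases. -/
theorem exists_equiv_fin_of_real {α : Type} [Finite α] (s : α → ℝ) :
    ∃ (n : ℕ) (e : α ≃ Fin n), ∀ a b, s a < s b → e a < e b := by
  obtain ⟨n, ⟨e⟩⟩ := Finite.exists_equiv_fin α
  refine ⟨n, e.trans (Tuple.sort (s ∘ e.symm)).symm, fun a b h => ?_⟩
  by_contra hn
  have := Tuple.monotone_sort (s ∘ e.symm) (not_lt.1 hn)
  simp at this
  exact absurd h (not_lt.2 this)

theorem exists_isHalf {j : ℕ} {t : ℝ} (b : ℕ) (hb : b < 2) (h0 : b = 0 → t ≤ 1 / 2)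
    (h1 : b = 1 → 1 / 2 ≤ t) : IsHalf j t (2 * j + b) := by
  interval_cases b
  · exact Or.inl ⟨rfl, h0 rfl⟩
  · exact Or.inr ⟨rfl, h1 rfl⟩

theorem cast_sub_one_sub {m i : ℕ} (h : i < m) : ((m - 1 - i : ℕ) : ℝ) = m - 1 - i := by
  obtain ⟨k, rfl⟩ := Nat.exists_eq_add_of_lt h
  rw [show i + k + 1 - 1 - i = k by omega]
  push_cast
  ring

/-- The points are read off by distance from the centre lines. One enumeration serves both orders
because horizontal and vertical distances agree on the diagonals. -/
theorem exists_word_of_mem_geomClass {m n : ℕ} {M : Matrix (Fin m) (Fin n) SignType}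
    {π : FinPermutation} (hπ : π ∈ geomClass M) :
    ∃ (N : ℕ) (e : π.carrier ≃ Fin N) (g : ℕ → ℕ), (∀ k < N, IsLetter (matrixData M) (g k)) ∧
      (∀ a b, π.lt₁ a b ↔ wordLt₁ g (e a) (e b)) ∧ ∀ a b, π.lt₂ a b ↔ wordLt₂ g (e a) (e b) := by
  obtain ⟨pt, hfig, h₁, h₂⟩ := hπ
  have := π.finite_carrier
  have st₁ := π.strictTotal₁
  have st₂ := π.strictTotal₂
  have key : ∀ a, ∃ (l J I : ℕ) (t u : ℝ), IsLetter (matrixData M) l ∧ (0 < t ∧ t < 1) ∧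
      (0 < u ∧ u < 1) ∧ |u - 1 / 2| = |t - 1 / 2| ∧ IsHalf J t l.unpair.1 ∧
      IsHalf I u l.unpair.2 ∧ (pt a).1 = J + t ∧ (pt a).2 = I + u := by
    intro a
    obtain ⟨i, j, t, ht0, ht1, h⟩ := hfig a
    have hi := cast_sub_one_sub i.2
    -- A point at the centre of a cell fits both halves. The same choice `b` must fix the half
    -- column and the half row, so that the parities suit the diagonal.
    obtain ⟨b, hb, hb0, hb1⟩ : ∃ b < 2, (b = 0 → t ≤ 1 / 2) ∧ (b = 1 → 1 / 2 ≤ t) := by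
      rcases le_total t (1 / 2) with h | h
      · exact ⟨0, by simp, fun _ => h, by simp⟩
      · exact ⟨1, by simp, by simp, fun _ => h⟩
    rcases h with ⟨hM, hp⟩ | ⟨hM, hp⟩
    · refine ⟨Nat.pair (2 * j + b) (2 * (m - 1 - i) + b), j, m - 1 - i, t, t, ?_, ⟨ht0, ht1⟩,
        ⟨ht0, ht1⟩, rfl, ?_, ?_, ?_, ?_⟩
      · rw [isLetter_matrixData_iff]
        refine ⟨i, j, ?_, ?_, Or.inl ⟨hM, ?_⟩⟩ <;> simp only [Nat.unpair_pair] <;> omega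
      · rw [Nat.unpair_pair]; exact exists_isHalf b hb hb0 hb1
      · rw [Nat.unpair_pair]; exact exists_isHalf b hb hb0 hb1
      · rw [hp]
      · rw [hp, hi]
    · refine ⟨Nat.pair (2 * j + b) (2 * (m - 1 - i) + (1 - b)), j, m - 1 - i, t, 1 - t, ?_,
        ⟨ht0, ht1⟩, ⟨by linarith, by linarith⟩, ?_, ?_, ?_, ?_, ?_⟩
      · rw [isLetter_matrixData_iff]
        refine ⟨i, j, ?_, ?_, Or.inr ⟨hM, ?_⟩⟩ <;> simp only [Nat.unpair_pair] <;> omega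
      · rw [← abs_neg]; congr 1; ring
      · rw [Nat.unpair_pair]; exact exists_isHalf b hb hb0 hb1
      · rw [Nat.unpair_pair]
        refine exists_isHalf (1 - b) (by omega) (fun h => ?_) fun h => ?_
        · have := hb1 (by omega); linarith
        · have := hb0 (by omega); linarith
      · rw [hp]
      · rw [hp, hi]; ring
  choose l J I t u hl ht hu hut hJ hI hx hy using key
  -- Points at equal distance are numbered arbitrarily: distinct ones never share a half strip, as
  -- they would share a coordinate.
  obtain ⟨N, e, he⟩ := exists_equiv_fin_of_real fun a => |t a - 1 / 2|
  refine ⟨N, e, fun k => if h : k < N then l (e.symm ⟨k, h⟩) else 0, ?_, ?_, ?_⟩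
  · intro k hk; simp only [hk, dite_true]; exact hl _
  · intro a b
    rw [h₁, hx, hx]
    simp only [wordLt₁, Fin.is_lt, dite_true, Fin.eta, Equiv.symm_apply_apply]
    refine add_lt_add_iff_stripLt (ht a) (ht b) (hJ a) (hJ b) (he a b) (he b a) ?_
    rw [← hx, ← hx]
    constructor
    · intro h
      obtain rfl : a = b := st₁.trichotomous a b (by rw [h₁, h]; exact lt_irrefl _)
        (by rw [h₁, h]; exact lt_irrefl _)
      exact ⟨rfl, rfl⟩
    · rintro ⟨-, h⟩
      rw [e.injective (Fin.ext h)]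
  · intro a b
    rw [h₂, hy, hy]
    simp only [wordLt₂, Fin.is_lt, dite_true, Fin.eta, Equiv.symm_apply_apply]
    refine add_lt_add_iff_stripLt (hu a) (hu b) (hI a) (hI b)
      (by rw [hut, hut]; exact he a b) (by rw [hut, hut]; exact he b a) ?_
    rw [← hy, ← hy]
    constructor
    · intro h
      obtain rfl : a = b := st₂.trichotomous a b (by rw [h₂, h]; exact lt_irrefl _)
        (by rw [h₂, h]; exact lt_irrefl _)
      exact ⟨rfl, rfl⟩
    · rintro ⟨-, h⟩
      rw [e.injective (Fin.ext h)]

/-- The offset of the point in position `k` of a word of length `N` in a half strip with index of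
the parity of `c`. -/
noncomputable def halfOffset (N c k : ℕ) : ℝ :=
  if c % 2 = 1 then 1 / 2 + (k + 1) / (2 * (N + 1)) else 1 / 2 - (k + 1) / (2 * (N + 1))

/-- The summand `1` in the numerator keeps the points off the centre lines, the one in the
denominator keeps them inside the open cell. -/
theorem halfOffset_aux {N k : ℕ} (hk : k < N) :
    (0 : ℝ) < (k + 1) / (2 * (N + 1)) ∧ ((k : ℝ) + 1) / (2 * (N + 1)) < 1 / 2 := by
  have : (k : ℝ) + 1 ≤ N := by exact_mod_cast hk
  refine ⟨by positivity, ?_⟩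
  rw [div_lt_div_iff₀ (by positivity) (by norm_num)]
  linarith

theorem halfOffset_mem {N c k : ℕ} (hk : k < N) :
    0 < halfOffset N c k ∧ halfOffset N c k < 1 := by
  have := halfOffset_aux hk
  unfold halfOffset
  split_ifs <;> constructor <;> linarith

theorem abs_halfOffset {N c k : ℕ} (hk : k < N) :
    |halfOffset N c k - 1 / 2| = (k + 1) / (2 * (N + 1)) := by
  have := halfOffset_aux hk
  unfold halfOffset
  split_ifs
  · rw [abs_of_nonneg] <;> linarith
  · rw [abs_of_nonpos] <;> linarith

theorem isHalf_halfOffset {N c k : ℕ} (hk : k < N) : IsHalf (c / 2) (halfOffset N c k) c := by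
  have := halfOffset_aux hk
  unfold halfOffset IsHalf
  split_ifs with h
  · exact Or.inr ⟨by omega, by linarith⟩
  · exact Or.inl ⟨by omega, by linarith⟩

theorem abs_halfOffset_lt_iff {N c c' p q : ℕ} (hp : p < N) (hq : q < N) :
    |halfOffset N c p - 1 / 2| < |halfOffset N c' q - 1 / 2| ↔ p < q := by
  rw [abs_halfOffset hp, abs_halfOffset hq, div_lt_div_iff_of_pos_right (by positivity)]
  simp

/-- Offsets lie strictly between `0` and `1`, so the strips agree; equal distances force equal
positions, and the distance being positive, the side of the centre line is determined too. -/
theorem add_halfOffset_eq_iff {N c c' p q : ℕ} (hp : p < N) (hq : q < N) :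
    ((c / 2 : ℕ) : ℝ) + halfOffset N c p = ((c' / 2 : ℕ) : ℝ) + halfOffset N c' q ↔
      c = c' ∧ p = q := by
  constructor
  · intro h
    have h1 := halfOffset_mem (c := c) hp
    have h2 := halfOffset_mem (c := c') hq
    have hj : c / 2 = c' / 2 := by
      rcases lt_trichotomy (c / 2) (c' / 2) with hlt | heq | hlt
      · have : ((c / 2 : ℕ) : ℝ) + 1 ≤ (c' / 2 : ℕ) := by exact_mod_cast hlt
        linarith
      · exact heq
      · have : ((c' / 2 : ℕ) : ℝ) + 1 ≤ (c / 2 : ℕ) := by exact_mod_cast hlt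
        linarith
    have ht : halfOffset N c p = halfOffset N c' q := by rw [hj] at h; linarith
    have hpq : p = q := by
      have e1 := abs_halfOffset_lt_iff (c := c) (c' := c') hp hq
      have e2 := abs_halfOffset_lt_iff (c := c') (c' := c) hq hp
      rw [ht] at e1 e2
      simp only [lt_self_iff_false, false_iff] at e1 e2
      omega
    subst hpq
    refine ⟨?_, rfl⟩
    have h3 := halfOffset_aux hp
    unfold halfOffset at ht
    split_ifs at ht <;> first | omega | linarith
  · rintro ⟨rfl, rfl⟩; rfl

theorem add_halfOffset_lt_iff {N c c' p q : ℕ} (hp : p < N) (hq : q < N) :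
    ((c / 2 : ℕ) : ℝ) + halfOffset N c p < ((c' / 2 : ℕ) : ℝ) + halfOffset N c' q ↔
      StripLt c p c' q :=
  add_lt_add_iff_stripLt (halfOffset_mem hp) (halfOffset_mem hq) (isHalf_halfOffset hp)
    (isHalf_halfOffset hq) (abs_halfOffset_lt_iff hp hq).1 (abs_halfOffset_lt_iff hq hp).1
    (add_halfOffset_eq_iff hp hq)

theorem isStrictTotalOrder_of_real {α : Type} {f : α → ℝ} (hf : Function.Injective f) :
    IsStrictTotalOrder α fun a b => f a < f b where
  trichotomous _ _ h h' := hf (le_antisymm (not_lt.1 h') (not_lt.1 h))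
  irrefl _ := lt_irrefl _
  trans _ _ _ := lt_trans

theorem exists_mem_geomClass_of_word {m n : ℕ} {M : Matrix (Fin m) (Fin n) SignType} {N : ℕ}
    {g : ℕ → ℕ} (hg : ∀ k < N, IsLetter (matrixData M) (g k)) :
    ∃ π ∈ geomClass M, ∃ e : π.carrier ≃ Fin N,
      (∀ a b, π.lt₁ a b ↔ wordLt₁ g (e a) (e b)) ∧ ∀ a b, π.lt₂ a b ↔ wordLt₂ g (e a) (e b) := by
  let px : Fin N → ℝ := fun k => (((g k).unpair.1 / 2 : ℕ) : ℝ) + halfOffset N (g k).unpair.1 k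
  let py : Fin N → ℝ := fun k => (((g k).unpair.2 / 2 : ℕ) : ℝ) + halfOffset N (g k).unpair.2 k
  refine ⟨⟨Fin N, inferInstance, fun a b => px a < px b, fun a b => py a < py b,
    isStrictTotalOrder_of_real fun a b h => Fin.ext ((add_halfOffset_eq_iff a.2 b.2).1 h).2,
    isStrictTotalOrder_of_real fun a b h => Fin.ext ((add_halfOffset_eq_iff a.2 b.2).1 h).2⟩,
    ⟨fun k => (px k, py k), fun k => ?_, fun _ _ => Iff.rfl, fun _ _ => Iff.rfl⟩,
    Equiv.refl _, fun a b => add_halfOffset_lt_iff a.2 b.2, fun a b => add_halfOffset_lt_iff a.2 b.2⟩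
  obtain ⟨i, j, hj, hi, h⟩ := (isLetter_matrixData_iff M _).1 (hg k k.2)
  have hi' := cast_sub_one_sub i.2
  obtain ⟨h0, h1⟩ := halfOffset_mem (c := (g k).unpair.1) k.2
  refine ⟨i, j, _, h0, h1, ?_⟩
  simp only [px, py, hj, hi, hi']
  -- Equal parities give the same offset `t` in both directions, opposite parities give `t` and `1 -
  -- t`: exactly the two diagonals.
  rcases h with ⟨hM, hp⟩ | ⟨hM, hp⟩
  · refine Or.inl ⟨hM, ?_⟩
    rw [halfOffset, halfOffset, hp]
  · refine Or.inr ⟨hM, ?_⟩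
    rw [Prod.mk.injEq]
    refine ⟨rfl, ?_⟩
    unfold halfOffset
    split_ifs <;> first | omega | ring

/-- A sentence belongs to the theory of a geometric grid class if and only if it holds for all
words over the letters of the matrix. -/
theorem mem_msoTheory_geomClass_iff {m n : ℕ} (M : Matrix (Fin m) (Fin n) SignType)
    {θ : MSOFormula} (hθ : θ.IsSentence) :
    θ ∈ msoTheory (geomClass M) ↔ ∀ (N : ℕ) (g : ℕ → ℕ),
      (∀ k < N, IsLetter (matrixData M) (g k)) →
        θ.RelSat (wordLt₁ g) (wordLt₂ g) N (fun _ => ∅) fun _ => ∅ := by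
  constructor
  · rintro ⟨-, h⟩ N g hg
    obtain ⟨π, hπ, e, h₁, h₂⟩ := exists_mem_geomClass_of_word hg
    exact (MSOFormula.models_iff_relSat e h₁ h₂ θ).1 (h π hπ)
  · refine fun h => ⟨hθ, fun π hπ => ?_⟩
    obtain ⟨N, e, g, hg, h₁, h₂⟩ := exists_word_of_mem_geomClass hπ
    exact (MSOFormula.models_iff_relSat e h₁ h₂ θ).2 (h N g hg)

/-! ### Digits -/

/-- The digit number `i` of `e` in base `B`. -/
def baseDigit (B e i : ℕ) : ℕ := e / B ^ i % B

theorem exists_baseDigit (B : ℕ) (f : ℕ → ℕ) (hf : ∀ i, f i < B) (K : ℕ) :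
    ∃ e < B ^ K, ∀ i < K, baseDigit B e i = f i := by
  have hB : 0 < B := (Nat.zero_le _).trans_lt (hf 0)
  induction K generalizing f with
  | zero => exact ⟨0, by simp, by simp⟩
  | succ K ih =>
    obtain ⟨e, he, h⟩ := ih (fun i => f (i + 1)) fun i => hf _
    refine ⟨e * B + f 0, ?_, fun i hi => ?_⟩
    · rw [pow_succ]
      calc e * B + f 0 < e * B + B := Nat.add_lt_add_left (hf 0) _
        _ = (e + 1) * B := by ring
        _ ≤ B ^ K * B := Nat.mul_le_mul_right B he
    · unfold baseDigit
      rcases i with _ | i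
      · simp [Nat.add_mod, Nat.mod_eq_of_lt (hf 0)]
      · have e1 : (e * B + f 0) / B = e := by
          rw [add_comm, Nat.add_mul_div_right _ _ hB, Nat.div_eq_of_lt (hf 0), zero_add]
        rw [pow_succ', ← Nat.div_div_eq_div_mul, e1]
        exact h i (by omega)

/-- The set of positions coded by `e` for the variable number `i`. -/
def track (e i : ℕ) : Set ℕ := {a | baseDigit 2 e (Nat.pair i a) = 1}

/-- The bit at place `Nat.pair i a` tells whether `a` belongs to the set numbered `i`, so one number
codes a whole assignment up to a finite bound. -/
theorem exists_track (T : ℕ → Set ℕ) (K : ℕ) :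
    ∃ e < 2 ^ K, ∀ i a, Nat.pair i a < K → (a ∈ track e i ↔ a ∈ T i) := by
  classical
  obtain ⟨e, he, h⟩ := exists_baseDigit 2
    (fun i => if i.unpair.2 ∈ T i.unpair.1 then 1 else 0) (fun i => by split_ifs <;> simp) K
  refine ⟨e, he, fun i a hK => ?_⟩
  change baseDigit 2 e (Nat.pair i a) = 1 ↔ _
  rw [h _ hK]
  simp

/-! ### Assignments coded by numbers and bounded quantifiers -/

namespace MSOFormula

/-- Satisfaction depends only on the part of the assignments that is in the universe. -/
theorem relSat_congr {R₁ R₂ : ℕ → ℕ → Prop} {n c : ℕ} (φ : MSOFormula) (hc : φ.toNat ≤ c)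
    {v v' V V' : ℕ → Set ℕ} (hv : ∀ x ≤ c, ∀ a < n, a ∈ v x ↔ a ∈ v' x)
    (hV : ∀ x ≤ c, ∀ a < n, a ∈ V x ↔ a ∈ V' x) :
    φ.RelSat R₁ R₂ n v V ↔ φ.RelSat R₁ R₂ n v' V' := by
  -- Pairing dominates its components, so all variable indices and subformula numbers that occur
  -- stay below `c`.
  have pl := Nat.left_le_pair
  have pr := Nat.right_le_pair
  have upd : ∀ {v v' : ℕ → Set ℕ}, (∀ x ≤ c, ∀ a < n, a ∈ v x ↔ a ∈ v' x) →
      ∀ (x : ℕ) (B : Set ℕ), ∀ y ≤ c, ∀ a < n,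
        a ∈ Function.update v x B y ↔ a ∈ Function.update v' x B y := by
    intro v v' h x B y hy a ha
    by_cases hxy : y = x
    · subst hxy; simp
    · simp only [Function.update_of_ne hxy, h y hy a ha]
  induction φ generalizing v v' V V' with
  | eq x y =>
    have := pl x y
    have := pr x y
    simp only [toNat] at hc
    simp only [RelSat]
    exact exists_congr fun a => and_congr_right fun ha =>
      and_congr (hv x (by omega) a ha) (hv y (by omega) a ha)
  | mem x y =>
    have := pl x y
    have := pr x y
    simp only [toNat] at hc
    simp only [RelSat]
    exact exists_congr fun a => and_congr_right fun ha =>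
      and_congr (hv x (by omega) a ha) (hV y (by omega) a ha)
  | lt₁ x y | lt₂ x y =>
    have := pl x y
    have := pr x y
    simp only [toNat] at hc
    simp only [RelSat]
    exact exists_congr fun a => and_congr_right fun ha =>
      exists_congr fun b => and_congr_right fun hb =>
      and_congr (hv x (by omega) a ha) (and_congr_left' (hv y (by omega) b hb))
  | neg φ ih =>
    simp only [toNat] at hc
    exact not_congr (ih (by omega) hv hV)
  | conj φ ψ h h' | disj φ ψ h h' | imp φ ψ h h' | iff φ ψ h h' =>
    have := pl φ.toNat ψ.toNat
    have := pr φ.toNat ψ.toNat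
    simp only [toNat] at hc
    simp only [RelSat, h (by omega) hv hV, h' (by omega) hv hV]
  | ex x φ ih =>
    have := pr x φ.toNat
    simp only [toNat] at hc
    exact exists_congr fun a => and_congr_right fun _ => ih (by omega) (upd hv x _) hV
  | all x φ ih =>
    have := pr x φ.toNat
    simp only [toNat] at hc
    exact forall₂_congr fun a _ => ih (by omega) (upd hv x _) hV
  | exSet x φ ih =>
    have := pr x φ.toNat
    simp only [toNat] at hc
    exact exists_congr fun a => ih (by omega) hv (upd hV x _)
  | allSet x φ ih =>
    have := pr x φ.toNat
    simp only [toNat] at hc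
    exact forall_congr' fun a => ih (by omega) hv (upd hV x _)

/-- Bound for the bits of a code of assignments of the variables up to `c`, on a universe of size
`n`; the element variable `x` has the number `2 * x`, the set variable `X` the number
`2 * X + 1`. -/
def bitBound (c n : ℕ) : ℕ := Nat.pair (2 * c + 2) n

theorem pair_lt_bitBound {c n i a : ℕ} (hi : i ≤ 2 * c + 1) (ha : a < n) :
    Nat.pair i a < bitBound c n :=
  (Nat.pair_lt_pair_left a (Nat.lt_succ_of_le hi)).trans (Nat.pair_lt_pair_right _ ha)

/-- The codes `e` and `e'` agree except for the variable number `i`. -/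
def AgreeOff (K i e e' : ℕ) : Prop :=
  ∀ j < K, j.unpair.1 = i ∨ baseDigit 2 e' j = baseDigit 2 e j

/-- The code `e'` results from `e` by giving the variable number `i` the value `{a}`. -/
def AssignElem (K n i a e e' : ℕ) : Prop :=
  AgreeOff K i e e' ∧ ∀ k < n, baseDigit 2 e' (Nat.pair i k) = 1 ↔ k = a

/-- Satisfaction under coded assignments. -/
def CodedSat (R₁ R₂ : ℕ → ℕ → Prop) (n e : ℕ) (φ : MSOFormula) : Prop :=
  φ.RelSat R₁ R₂ n (fun x => track e (2 * x)) fun X => track e (2 * X + 1)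

variable {R₁ R₂ : ℕ → ℕ → Prop} {c n : ℕ}

theorem AgreeOff.mem_track_iff {i e e' j a : ℕ} (h : AgreeOff (bitBound c n) i e e')
    (hj : j ≤ 2 * c + 1) (ha : a < n) (hij : j ≠ i) : a ∈ track e' j ↔ a ∈ track e j := by
  rcases h _ (pair_lt_bitBound hj ha) with h | h
  · simp [hij] at h
  · change _ = 1 ↔ _ = 1; rw [h]

theorem exists_agreeOff (e i : ℕ) (B : Set ℕ) :
    ∃ e' < 2 ^ bitBound c n, AgreeOff (bitBound c n) i e e' ∧
      ∀ k, Nat.pair i k < bitBound c n → (k ∈ track e' i ↔ k ∈ B) := by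
  obtain ⟨e', he', h⟩ := exists_track (Function.update (track e) i B) (bitBound c n)
  refine ⟨e', he', fun j hj => ?_, fun k hk => by simpa using h i k hk⟩
  by_cases hij : j.unpair.1 = i
  · exact Or.inl hij
  · right
    have := h j.unpair.1 j.unpair.2 (by simpa using hj)
    rw [Function.update_of_ne hij] at this
    change baseDigit 2 e' _ = 1 ↔ baseDigit 2 e _ = 1 at this
    rw [Nat.pair_unpair] at this
    have b1 : baseDigit 2 e' j < 2 := Nat.mod_lt _ (by norm_num)
    have b2 : baseDigit 2 e j < 2 := Nat.mod_lt _ (by norm_num)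
    omega

/-- By `relSat_congr` only finitely many bits matter, so any admissible `e'` represents the updated
assignment. Even and odd numbers keep element and set variables apart. -/
theorem codedSat_iff_update_elem {φ : MSOFormula} (hc : φ.toNat ≤ c) {x a e e' : ℕ} (hx : x ≤ c)
    (h : AssignElem (bitBound c n) n (2 * x) a e e') :
    φ.CodedSat R₁ R₂ n e' ↔ φ.RelSat R₁ R₂ n
      (Function.update (fun x => track e (2 * x)) x {a}) fun X => track e (2 * X + 1) := by
  refine relSat_congr φ hc (fun y hy k hk => ?_) fun y hy k hk =>
    h.1.mem_track_iff (by omega) hk (by omega)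
  by_cases hxy : y = x
  · subst hxy
    simpa [track] using h.2 k hk
  · rw [Function.update_of_ne hxy]
    exact h.1.mem_track_iff (by omega) hk (by omega)

theorem codedSat_iff_update_set {φ : MSOFormula} (hc : φ.toNat ≤ c) {X e e' : ℕ} (hX : X ≤ c)
    {B : Set ℕ} (h : AgreeOff (bitBound c n) (2 * X + 1) e e')
    (hB : ∀ k < n, k ∈ track e' (2 * X + 1) ↔ k ∈ B) :
    φ.CodedSat R₁ R₂ n e' ↔ φ.RelSat R₁ R₂ n (fun x => track e (2 * x))
      (Function.update (fun X => track e (2 * X + 1)) X B) := by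
  refine relSat_congr φ hc (fun y hy k hk => h.mem_track_iff (by omega) hk (by omega))
    fun y hy k hk => ?_
  by_cases hxy : y = X
  · subst hxy
    simpa using hB k hk
  · rw [Function.update_of_ne hxy]
    exact h.mem_track_iff (by omega) hk (by omega)

theorem exists_assignElem {x : ℕ} (hx : x ≤ c) (a e : ℕ) :
    ∃ e' < 2 ^ bitBound c n, AssignElem (bitBound c n) n (2 * x) a e e' := by
  obtain ⟨e', he', h, hB⟩ := exists_agreeOff (c := c) (n := n) e (2 * x) {a}
  exact ⟨e', he', h, fun k hk => hB k (pair_lt_bitBound (by omega) hk)⟩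

theorem codedSat_ex {φ : MSOFormula} (hc : φ.toNat ≤ c) {x e : ℕ} (hx : x ≤ c) :
    (ex x φ).CodedSat R₁ R₂ n e ↔ ∃ a < n, ∃ e' < 2 ^ bitBound c n,
      AssignElem (bitBound c n) n (2 * x) a e e' ∧ φ.CodedSat R₁ R₂ n e' := by
  refine exists_congr fun a => and_congr_right fun _ => ⟨fun h => ?_, ?_⟩
  · obtain ⟨e', he', h'⟩ := exists_assignElem hx a e
    exact ⟨e', he', h', (codedSat_iff_update_elem hc hx h').2 h⟩
  · rintro ⟨e', -, h', h⟩
    exact (codedSat_iff_update_elem hc hx h').1 h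

/-- This replaces a quantifier over all subsets of `ℕ` by a bounded search: a set matters only
through its elements below `n`, and those fit into a code below `2 ^ bitBound c n`. -/
theorem codedSat_exSet {φ : MSOFormula} (hc : φ.toNat ≤ c) {X e : ℕ} (hX : X ≤ c) :
    (exSet X φ).CodedSat R₁ R₂ n e ↔ ∃ e' < 2 ^ bitBound c n,
      AgreeOff (bitBound c n) (2 * X + 1) e e' ∧ φ.CodedSat R₁ R₂ n e' := by
  constructor
  · rintro ⟨B, h⟩
    obtain ⟨e', he', h', hB⟩ := exists_agreeOff (c := c) (n := n) e (2 * X + 1) B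
    exact ⟨e', he', h', (codedSat_iff_update_set hc hX h'
      fun k hk => hB k (pair_lt_bitBound (by omega) hk)).2 h⟩
  · rintro ⟨e', -, h', h⟩
    exact ⟨_, (codedSat_iff_update_set hc hX h' fun _ _ => Iff.rfl).1 h⟩

/-- For fixed `a` an admissible code exists and all such codes give the same truth value, so
quantifying over them universally or existentially amounts to the same. -/
theorem codedSat_all {φ : MSOFormula} (hc : φ.toNat ≤ c) {x e : ℕ} (hx : x ≤ c) :
    (all x φ).CodedSat R₁ R₂ n e ↔ ¬ ∃ a < n, ∃ e' < 2 ^ bitBound c n,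
      AssignElem (bitBound c n) n (2 * x) a e e' ∧ ¬ φ.CodedSat R₁ R₂ n e' := by
  push Not
  refine forall₂_congr fun a _ => ⟨?_, fun h => ?_⟩
  · intro h e' _ h'
    exact (codedSat_iff_update_elem hc hx h').2 h
  · obtain ⟨e', he', h'⟩ := exists_assignElem hx a e
    exact (codedSat_iff_update_elem hc hx h').1 (h e' he' h')

theorem codedSat_allSet {φ : MSOFormula} (hc : φ.toNat ≤ c) {X e : ℕ} (hX : X ≤ c) :
    (allSet X φ).CodedSat R₁ R₂ n e ↔ ¬ ∃ e' < 2 ^ bitBound c n,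
      AgreeOff (bitBound c n) (2 * X + 1) e e' ∧ ¬ φ.CodedSat R₁ R₂ n e' := by
  push Not
  constructor
  · intro h e' _ h'
    exact (codedSat_iff_update_set hc hX h' fun _ _ => Iff.rfl).2 (h _)
  · intro h B
    obtain ⟨e', he', h', hB⟩ := exists_agreeOff (c := c) (n := n) e (2 * X + 1) B
    exact (codedSat_iff_update_set hc hX h'
      fun k hk => hB k (pair_lt_bitBound (by omega) hk)).1 (h e' he' h')

end MSOFormula

/-! ### Primitive recursion -/

section Primrec

variable {α : Type} [Primcodable α]

theorem PrimrecPred.exists_lt_of {f : α → ℕ} {P : α → ℕ → Prop} (hf : Primrec f)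
    (hP : PrimrecPred fun q : α × ℕ => P q.1 q.2) : PrimrecPred fun a => ∃ x < f a, P a x :=
  ((PrimrecRel.exists_mem_list (R := fun x a => P a x)
    (hP.comp (Primrec.snd.pair Primrec.fst))).comp (Primrec.list_range.comp hf) Primrec.id).of_eq
      fun a => by simp

theorem PrimrecPred.forall_lt_of {f : α → ℕ} {P : α → ℕ → Prop} (hf : Primrec f)
    (hP : PrimrecPred fun q : α × ℕ => P q.1 q.2) : PrimrecPred fun a => ∀ x < f a, P a x :=
  ((PrimrecRel.forall_mem_list (R := fun x a => P a x)
    (hP.comp (Primrec.snd.pair Primrec.fst))).comp (Primrec.list_range.comp hf) Primrec.id).of_eq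
      fun a => by simp

theorem PrimrecPred.imp {P Q : α → Prop} (hP : PrimrecPred P) (hQ : PrimrecPred Q) :
    PrimrecPred fun a => P a → Q a :=
  (hP.not.or hQ).of_eq fun _ => imp_iff_not_or.symm

theorem PrimrecPred.iff {P Q : α → Prop} (hP : PrimrecPred P) (hQ : PrimrecPred Q) :
    PrimrecPred fun a => P a ↔ Q a :=
  ((hP.imp hQ).and (hQ.imp hP)).of_eq fun _ => iff_iff_implies_and_implies.symm

theorem Primrec.pow {f g : α → ℕ} (hf : Primrec f) (hg : Primrec g) :
    Primrec fun a => f a ^ g a :=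
  (Primrec₂.unpaired'.1 Nat.Primrec.pow).comp hf hg

theorem Primrec.unpair_fst {f : α → ℕ} (hf : Primrec f) : Primrec fun a => (f a).unpair.1 :=
  Primrec.fst.comp (Primrec.unpair.comp hf)

theorem Primrec.unpair_snd {f : α → ℕ} (hf : Primrec f) : Primrec fun a => (f a).unpair.2 :=
  Primrec.snd.comp (Primrec.unpair.comp hf)

theorem Primrec.baseDigit {B e i : α → ℕ} (hB : Primrec B) (he : Primrec e) (hi : Primrec i) :
    Primrec fun a => baseDigit (B a) (e a) (i a) :=
  Primrec.nat_mod.comp (Primrec.nat_div.comp he (hB.pow hi)) hB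

theorem PrimrecPred.nat_eq {f g : α → ℕ} (hf : Primrec f) (hg : Primrec g) :
    PrimrecPred fun a => f a = g a :=
  Primrec.eq.comp hf hg

theorem PrimrecPred.mem_track {e i k : α → ℕ} (he : Primrec e) (hi : Primrec i)
    (hk : Primrec k) : PrimrecPred fun a => k a ∈ track (e a) (i a) :=
  .nat_eq (.baseDigit (.const 2) he (Primrec₂.natPair.comp hi hk)) (.const 1)

theorem PrimrecPred.stripLt {c p c' q : α → ℕ} (hc : Primrec c) (hp : Primrec p)
    (hc' : Primrec c') (hq : Primrec q) :
    PrimrecPred fun a => StripLt (c a) (p a) (c' a) (q a) :=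
  have hm : Primrec fun a => c a % 2 := Primrec.nat_mod.comp hc (.const 2)
  (Primrec.nat_lt.comp hc hc').or <| (PrimrecPred.nat_eq hc hc').and <|
    ((PrimrecPred.nat_eq hm (.const 1)).and (Primrec.nat_lt.comp hp hq)).or
      ((PrimrecPred.nat_eq hm (.const 0)).and (Primrec.nat_lt.comp hq hp))

theorem primrec_stateBound {L c : α → ℕ} (hL : Primrec L) (hc : Primrec c) :
    Primrec fun a => stateBound (L a) (c a) := by
  have h : Primrec₂ stateBound := by
    refine Primrec.nat_rec (f := fun L => 2 ^ (2 * L + 1)) (g := fun _ p => 2 ^ (p.2 * p.2 * 2))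
      ((Primrec.const 2).pow (Primrec.succ.comp (Primrec.nat_mul.comp (.const 2) .id))) ?_
    have hs : Primrec fun q : ℕ × ℕ × ℕ => q.2.2 := Primrec.snd.comp Primrec.snd
    exact (Primrec.const 2).pow (Primrec.nat_mul.comp (Primrec.nat_mul.comp hs hs) (.const 2))
  exact h.comp hL hc

/-! ### Satisfaction as a course-of-values recursion -/

namespace MSOFormula

theorem primrecPred_agreeOff {K i e e' : α → ℕ} (hK : Primrec K) (hi : Primrec i)
    (he : Primrec e) (he' : Primrec e') :
    PrimrecPred fun a => AgreeOff (K a) (i a) (e a) (e' a) := by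
  refine .forall_lt_of hK (.or (.nat_eq (.unpair_fst .snd) (hi.comp .fst)) (.nat_eq ?_ ?_))
  · exact .baseDigit (.const 2) (he'.comp .fst) .snd
  · exact .baseDigit (.const 2) (he.comp .fst) .snd

theorem primrecPred_assignElem {K n i b e e' : α → ℕ} (hK : Primrec K) (hn : Primrec n)
    (hi : Primrec i) (hb : Primrec b) (he : Primrec e) (he' : Primrec e') :
    PrimrecPred fun a => AssignElem (K a) (n a) (i a) (b a) (e a) (e' a) :=
  (primrecPred_agreeOff hK hi he he').and <| .forall_lt_of hn <|
    (PrimrecPred.mem_track (he'.comp .fst) (hi.comp .fst) .snd).iff (.nat_eq .snd (hb.comp .fst))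

/-- The satisfaction of the formula with Gödel number `d` under the assignment coded by `e`, in
terms of the satisfaction `val` of its subformulas. -/
def SatStep (R₁ R₂ : ℕ → ℕ → Prop) (K n : ℕ) (val : ℕ → ℕ → Prop) (d e : ℕ) : Prop :=
  (d % 13 = 0 ∧ ∃ a < n, a ∈ track e (2 * (d / 13).unpair.1) ∧
    a ∈ track e (2 * (d / 13).unpair.2)) ∨
  (d % 13 = 1 ∧ ∃ a < n, ∃ b < n, a ∈ track e (2 * (d / 13).unpair.1) ∧
    b ∈ track e (2 * (d / 13).unpair.2) ∧ R₁ a b) ∨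
  (d % 13 = 2 ∧ ∃ a < n, ∃ b < n, a ∈ track e (2 * (d / 13).unpair.1) ∧
    b ∈ track e (2 * (d / 13).unpair.2) ∧ R₂ a b) ∨
  (d % 13 = 3 ∧ ∃ a < n, a ∈ track e (2 * (d / 13).unpair.1) ∧
    a ∈ track e (2 * (d / 13).unpair.2 + 1)) ∨
  (d % 13 = 4 ∧ ¬ val (d / 13) e) ∨
  (d % 13 = 5 ∧ (val (d / 13).unpair.1 e ∧ val (d / 13).unpair.2 e)) ∨
  (d % 13 = 6 ∧ (val (d / 13).unpair.1 e ∨ val (d / 13).unpair.2 e)) ∨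
  (d % 13 = 7 ∧ (val (d / 13).unpair.1 e → val (d / 13).unpair.2 e)) ∨
  (d % 13 = 8 ∧ (val (d / 13).unpair.1 e ↔ val (d / 13).unpair.2 e)) ∨
  (d % 13 = 9 ∧ ∃ a < n, ∃ e' < 2 ^ K, AssignElem K n (2 * (d / 13).unpair.1) a e e' ∧
    val (d / 13).unpair.2 e') ∨
  (d % 13 = 10 ∧ ¬ ∃ a < n, ∃ e' < 2 ^ K, AssignElem K n (2 * (d / 13).unpair.1) a e e' ∧
    ¬ val (d / 13).unpair.2 e') ∨
  (d % 13 = 11 ∧ ∃ e' < 2 ^ K, AgreeOff K (2 * (d / 13).unpair.1 + 1) e e' ∧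
    val (d / 13).unpair.2 e') ∨
  (d % 13 = 12 ∧ ¬ ∃ e' < 2 ^ K, AgreeOff K (2 * (d / 13).unpair.1 + 1) e e' ∧
    ¬ val (d / 13).unpair.2 e')

theorem primrecPred_satStep {R₁ R₂ : α → ℕ → ℕ → Prop} {K n d e : α → ℕ}
    {val : α → ℕ → ℕ → Prop} (hR₁ : PrimrecPred fun q : α × ℕ × ℕ => R₁ q.1 q.2.1 q.2.2)
    (hR₂ : PrimrecPred fun q : α × ℕ × ℕ => R₂ q.1 q.2.1 q.2.2) (hK : Primrec K)
    (hn : Primrec n) (hval : PrimrecPred fun q : α × ℕ × ℕ => val q.1 q.2.1 q.2.2)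
    (hd : Primrec d) (he : Primrec e) :
    PrimrecPred fun a => SatStep (R₁ a) (R₂ a) (K a) (n a) (val a) (d a) (e a) := by
  have hr : ∀ r, PrimrecPred fun a => d a % 13 = r := fun r =>
    .nat_eq (Primrec.nat_mod.comp hd (.const 13)) (.const r)
  have hq : Primrec fun a => d a / 13 := Primrec.nat_div.comp hd (.const 13)
  have hl := hq.unpair_fst
  have hr2 := hq.unpair_snd
  have hx : Primrec fun a => 2 * (d a / 13).unpair.1 := Primrec.nat_mul.comp (.const 2) hl
  have hy : Primrec fun a => 2 * (d a / 13).unpair.2 := Primrec.nat_mul.comp (.const 2) hr2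
  have hX : Primrec fun a => 2 * (d a / 13).unpair.1 + 1 := Primrec.succ.comp hx
  have hY : Primrec fun a => 2 * (d a / 13).unpair.2 + 1 := Primrec.succ.comp hy
  have hE : Primrec fun a => 2 ^ K a := (Primrec.const 2).pow hK
  have v1 : PrimrecPred fun a => val a (d a / 13).unpair.1 (e a) :=
    hval.comp (Primrec.id.pair (hl.pair he))
  have v2 : PrimrecPred fun a => val a (d a / 13).unpair.2 (e a) :=
    hval.comp (Primrec.id.pair (hr2.pair he))
  have v0 : PrimrecPred fun a => val a (d a / 13) (e a) :=
    hval.comp (Primrec.id.pair (hq.pair he))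
  have vE : PrimrecPred fun q : α × ℕ => val q.1 (d q.1 / 13).unpair.2 q.2 :=
    hval.comp (Primrec.fst.pair ((hr2.comp .fst).pair .snd))
  have vEE : PrimrecPred fun q : (α × ℕ) × ℕ => val q.1.1 (d q.1.1 / 13).unpair.2 q.2 :=
    hval.comp ((Primrec.fst.comp .fst).pair ((hr2.comp (Primrec.fst.comp .fst)).pair .snd))
  have ff : Primrec fun q : (α × ℕ) × ℕ => q.1.1 := Primrec.fst.comp .fst
  have fs : Primrec fun q : (α × ℕ) × ℕ => q.1.2 := Primrec.snd.comp .fst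
  have assign : PrimrecPred fun q : (α × ℕ) × ℕ => AssignElem (K q.1.1) (n q.1.1)
      (2 * (d q.1.1 / 13).unpair.1) q.1.2 (e q.1.1) q.2 :=
    primrecPred_assignElem (hK.comp ff) (hn.comp ff) (hx.comp ff) fs (he.comp ff) .snd
  have agree : PrimrecPred fun q : α × ℕ => AgreeOff (K q.1)
      (2 * (d q.1 / 13).unpair.1 + 1) (e q.1) q.2 :=
    primrecPred_agreeOff (hK.comp .fst) (hX.comp .fst) (he.comp .fst) .snd
  have rel : ∀ {R : α → ℕ → ℕ → Prop}, (PrimrecPred fun q : α × ℕ × ℕ => R q.1 q.2.1 q.2.2) →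
      PrimrecPred fun a => ∃ b < n a, ∃ b' < n a, b ∈ track (e a) (2 * (d a / 13).unpair.1) ∧
        b' ∈ track (e a) (2 * (d a / 13).unpair.2) ∧ R a b b' := fun {R} hR =>
    .exists_lt_of hn <| .exists_lt_of (hn.comp .fst) <|
      (PrimrecPred.mem_track (he.comp ff) (hx.comp ff) fs).and <|
        (PrimrecPred.mem_track (he.comp ff) (hy.comp ff) .snd).and <|
          hR.comp (ff.pair (fs.pair .snd))
  refine ((hr 0).and ?_).or <| ((hr 1).and (rel hR₁)).or <| ((hr 2).and (rel hR₂)).or <|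
    ((hr 3).and ?_).or <| ((hr 4).and v0.not).or <| ((hr 5).and (v1.and v2)).or <|
    ((hr 6).and (v1.or v2)).or <| ((hr 7).and (v1.imp v2)).or <| ((hr 8).and (v1.iff v2)).or <|
    ((hr 9).and ?_).or <| ((hr 10).and (.not ?_)).or <| ((hr 11).and ?_).or <|
    (hr 12).and (.not ?_)
  · exact .exists_lt_of hn <| (PrimrecPred.mem_track (he.comp .fst) (hx.comp .fst) .snd).and
      (PrimrecPred.mem_track (he.comp .fst) (hy.comp .fst) .snd)
  · exact .exists_lt_of hn <| (PrimrecPred.mem_track (he.comp .fst) (hx.comp .fst) .snd).and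
      (PrimrecPred.mem_track (he.comp .fst) (hY.comp .fst) .snd)
  · exact .exists_lt_of hn <| .exists_lt_of (hE.comp .fst) <| assign.and vEE
  · exact .exists_lt_of hn <| .exists_lt_of (hE.comp .fst) <| assign.and vEE.not
  · exact .exists_lt_of hE <| agree.and vE
  · exact .exists_lt_of hE <| agree.and vE.not

/-- Correct values are needed only for smaller Gödel numbers, but there for all codes `e'`, since a
quantifier changes the assignment. -/
theorem satStep_iff {R₁ R₂ : ℕ → ℕ → Prop} {c n e : ℕ} {val : ℕ → ℕ → Prop} (φ : MSOFormula)
    (hc : φ.toNat ≤ c) (he : e < 2 ^ bitBound c n)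
    (hval : ∀ (ψ : MSOFormula), ψ.toNat < φ.toNat → ∀ e' < 2 ^ bitBound c n,
      (val ψ.toNat e' ↔ ψ.CodedSat R₁ R₂ n e')) :
    SatStep R₁ R₂ (bitBound c n) n val φ.toNat e ↔ φ.CodedSat R₁ R₂ n e := by
  have pl := Nat.left_le_pair
  have pr := Nat.right_le_pair
  have m : ∀ k r, r < 13 → (13 * k + r) % 13 = r ∧ (13 * k + r) / 13 = k := by
    intro k r hr; omega
  have m0 : ∀ k, 13 * k % 13 = 0 ∧ 13 * k / 13 = k := by intro k; omega
  cases φ with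
  | eq x y | lt₁ x y | lt₂ x y | mem x y =>
    simp [SatStep, toNat, m, m0, CodedSat, RelSat]
  | neg φ =>
    simp only [toNat] at hval
    have h := hval φ (by omega) e he
    simp [SatStep, toNat, m, h]
    rfl
  | conj φ ψ | disj φ ψ | imp φ ψ | iff φ ψ =>
    have := pl φ.toNat ψ.toNat
    have := pr φ.toNat ψ.toNat
    simp only [toNat] at hval
    have h := hval φ (by omega) e he
    have h' := hval ψ (by omega) e he
    simp [SatStep, toNat, m, h, h']
    rfl
  | ex x φ =>
    have := pl x φ.toNat
    have := pr x φ.toNat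
    simp only [toNat] at hval hc
    rw [codedSat_ex (c := c) (by omega) (by omega)]
    have h := hval φ (by omega)
    have hm := m (Nat.pair x φ.toNat) 9 (by norm_num)
    simp only [SatStep, toNat, hm.1, hm.2, Nat.unpair_pair]
    simp
    exact exists_congr fun a => and_congr_right fun _ => exists_congr fun e' =>
      and_congr_right fun he' => and_congr_right fun _ => h e' he'
  | all x φ =>
    have := pl x φ.toNat
    have := pr x φ.toNat
    simp only [toNat] at hval hc
    rw [codedSat_all (c := c) (by omega) (by omega)]
    have h := hval φ (by omega)
    have hm := m (Nat.pair x φ.toNat) 10 (by norm_num)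
    simp only [SatStep, toNat, hm.1, hm.2, Nat.unpair_pair]
    simp
    exact forall₂_congr fun a _ => forall₂_congr fun e' he' => imp_congr_right fun _ => h e' he'
  | exSet x φ =>
    have := pl x φ.toNat
    have := pr x φ.toNat
    simp only [toNat] at hval hc
    rw [codedSat_exSet (c := c) (by omega) (by omega)]
    have h := hval φ (by omega)
    have hm := m (Nat.pair x φ.toNat) 11 (by norm_num)
    simp only [SatStep, toNat, hm.1, hm.2, Nat.unpair_pair]
    simp
    exact exists_congr fun e' => and_congr_right fun he' => and_congr_right fun _ => h e' he'
  | allSet x φ =>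
    have := pl x φ.toNat
    have := pr x φ.toNat
    simp only [toNat] at hval hc
    rw [codedSat_allSet (c := c) (by omega) (by omega)]
    have h := hval φ (by omega)
    have hm := m (Nat.pair x φ.toNat) 12 (by norm_num)
    simp only [SatStep, toNat, hm.1, hm.2, Nat.unpair_pair]
    simp
    exact forall₂_congr fun e' he' => imp_congr_right fun _ => h e' he'

/-- The formula with a given Gödel number. -/
noncomputable def ofCode (d : ℕ) : MSOFormula := equivNat.symm d

theorem ofCode_toNat (φ : MSOFormula) : ofCode φ.toNat = φ := equivNat.symm_apply_apply φ

theorem toNat_ofCode (d : ℕ) : (ofCode d).toNat = d := equivNat.apply_symm_apply d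

/-- Satisfaction in words is primitive recursive: here `c` bounds the Gödel numbers of the formulas
under consideration, the word of length `n` is given by the digits of `w` to base `L`, and the
last argument codes the formula together with the assignment. -/
theorem primrecPred_codedSat : PrimrecPred fun q : (ℕ × ℕ × ℕ × ℕ) × ℕ =>
    q.2 / 2 ^ bitBound q.1.1 q.1.2.1 ≤ q.1.1 ∧
      (ofCode (q.2 / 2 ^ bitBound q.1.1 q.1.2.1)).CodedSat
        (wordLt₁ (baseDigit q.1.2.2.1 q.1.2.2.2)) (wordLt₂ (baseDigit q.1.2.2.1 q.1.2.2.2))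
        q.1.2.1 (q.2 % 2 ^ bitBound q.1.1 q.1.2.1) := by
  classical
  let f : ℕ × ℕ × ℕ × ℕ → ℕ → Bool := fun p i =>
    decide (i / 2 ^ bitBound p.1 p.2.1 ≤ p.1 ∧
      (ofCode (i / 2 ^ bitBound p.1 p.2.1)).CodedSat
        (wordLt₁ (baseDigit p.2.2.1 p.2.2.2)) (wordLt₂ (baseDigit p.2.2.1 p.2.2.2))
        p.2.1 (i % 2 ^ bitBound p.1 p.2.1))
  -- The list holds the values at all earlier arguments, and its length is the current argument `d *
  -- 2 ^ K + e`. With the formula as leading digit, smaller Gödel numbers precede under every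
  -- assignment.
  let G : (ℕ × ℕ × ℕ × ℕ) × List Bool → Prop := fun q =>
    q.2.length / 2 ^ bitBound q.1.1 q.1.2.1 ≤ q.1.1 ∧
      SatStep (wordLt₁ (baseDigit q.1.2.2.1 q.1.2.2.2)) (wordLt₂ (baseDigit q.1.2.2.1 q.1.2.2.2))
        (bitBound q.1.1 q.1.2.1) q.1.2.1
        (fun d e => q.2.getD (d * 2 ^ bitBound q.1.1 q.1.2.1 + e) false = true)
        (q.2.length / 2 ^ bitBound q.1.1 q.1.2.1) (q.2.length % 2 ^ bitBound q.1.1 q.1.2.1)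
  have hG : PrimrecPred G := by
    have c : Primrec fun q : (ℕ × ℕ × ℕ × ℕ) × List Bool => q.1.1 := Primrec.fst.comp .fst
    have n : Primrec fun q : (ℕ × ℕ × ℕ × ℕ) × List Bool => q.1.2.1 :=
      Primrec.fst.comp (Primrec.snd.comp .fst)
    have L : Primrec fun q : (ℕ × ℕ × ℕ × ℕ) × List Bool => q.1.2.2.1 :=
      Primrec.fst.comp (Primrec.snd.comp (Primrec.snd.comp .fst))
    have w : Primrec fun q : (ℕ × ℕ × ℕ × ℕ) × List Bool => q.1.2.2.2 :=
      Primrec.snd.comp (Primrec.snd.comp (Primrec.snd.comp .fst))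
    have len : Primrec fun q : (ℕ × ℕ × ℕ × ℕ) × List Bool => q.2.length :=
      Primrec.list_length.comp .snd
    have K : Primrec fun q : (ℕ × ℕ × ℕ × ℕ) × List Bool => bitBound q.1.1 q.1.2.1 :=
      Primrec₂.natPair.comp (Primrec.succ.comp (Primrec.succ.comp
        (Primrec.nat_mul.comp (.const 2) c))) n
    have E : Primrec fun q : (ℕ × ℕ × ℕ × ℕ) × List Bool => 2 ^ bitBound q.1.1 q.1.2.1 :=
      (Primrec.const 2).pow K
    have D := Primrec.nat_div.comp len E
    have a1 : Primrec fun q : ((ℕ × ℕ × ℕ × ℕ) × List Bool) × ℕ × ℕ => q.2.1 :=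
      Primrec.fst.comp .snd
    have a2 : Primrec fun q : ((ℕ × ℕ × ℕ × ℕ) × List Bool) × ℕ × ℕ => q.2.2 :=
      Primrec.snd.comp .snd
    have g1 := Primrec.baseDigit (L.comp .fst) (w.comp .fst) a1
    have g2 := Primrec.baseDigit (L.comp .fst) (w.comp .fst) a2
    refine (Primrec.nat_le.comp D c).and (primrecPred_satStep ?_ ?_ K n ?_ D
      (Primrec.nat_mod.comp len E))
    · exact .stripLt g1.unpair_fst a1 g2.unpair_fst a2
    · exact .stripLt g1.unpair_snd a1 g2.unpair_snd a2
    · exact Primrec.eq.comp ((Primrec.list_getD false).comp (Primrec.snd.comp .fst)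
        (Primrec.nat_add.comp (Primrec.nat_mul.comp a1 (E.comp .fst)) a2)) (.const true)
  have hf : Primrec₂ f := by
    refine Primrec.nat_strong_rec f (g := fun p l => some (decide (G (p, l))))
      (Primrec.option_some.comp hG.decide) fun p i => ?_
    rw [Option.some_inj, decide_eq_decide]
    simp only [G, List.length_map, List.length_range]
    refine and_congr_right fun hc => ?_
    set K := bitBound p.1 p.2.1 with hK
    set d := i / 2 ^ K with hd
    have := satStep_iff (R₁ := wordLt₁ (baseDigit p.2.2.1 p.2.2.2))
      (R₂ := wordLt₂ (baseDigit p.2.2.1 p.2.2.2)) (c := p.1) (n := p.2.1) (e := i % 2 ^ K)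
      (val := fun d e => (List.map (f p) (List.range i)).getD (d * 2 ^ K + e) false = true)
      (ofCode d) (by rw [toNat_ofCode]; exact hc) (Nat.mod_lt _ (by positivity)) ?_
    · rwa [toNat_ofCode] at this
    · intro ψ hψ e' he'
      rw [toNat_ofCode] at hψ
      rw [← hK] at he'
      have hlt : ψ.toNat * 2 ^ K + e' < i := by
        have h1 : (ψ.toNat + 1) * 2 ^ K ≤ d * 2 ^ K := Nat.mul_le_mul_right _ hψ
        have h2 : d * 2 ^ K ≤ i := Nat.div_mul_le_self _ _
        rw [add_mul, one_mul] at h1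
        omega
      have e1 : (ψ.toNat * 2 ^ K + e') / 2 ^ K = ψ.toNat := by
        rw [add_comm, Nat.add_mul_div_right _ _ (by positivity), Nat.div_eq_of_lt he', zero_add]
      have e2 : (ψ.toNat * 2 ^ K + e') % 2 ^ K = e' := by
        rw [add_comm, Nat.add_mul_mod_self_right, Nat.mod_eq_of_lt he']
      have hle : ψ.toNat ≤ p.1 := by omega
      simp [List.getD_eq_getElem?_getD, hlt, f, ← hK, e1, e2, ofCode_toNat, hle]
  exact Primrec.primrecPred hf

end MSOFormula

end Primrec

/-! ### The decision procedure -/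

/-- A bound for the codes of the letters of a matrix. -/
def letterBound (D : ℕ × ℕ × List (List ℤ)) : ℕ := (2 * D.1 + 2 * D.2.1 + 1) ^ 2

theorem IsLetter.lt_letterBound {D : ℕ × ℕ × List (List ℤ)} {l : ℕ} (h : IsLetter D l) :
    l < letterBound D := by
  obtain ⟨h1, h2, -⟩ := h
  calc l = Nat.pair l.unpair.1 l.unpair.2 := (Nat.pair_unpair l).symm
    _ < (max l.unpair.1 l.unpair.2 + 1) ^ 2 := Nat.pair_lt_max_add_one_sq _ _
    _ ≤ letterBound D := Nat.pow_le_pow_left (by omega) 2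

/-- A bound for the length of a shortest word violating `θ`. -/
def lengthBound (D : ℕ × ℕ × List (List ℤ)) (θ : MSOFormula) : ℕ :=
  stateBound (letterBound D) θ.toNat

/-- The formula `θ` holds in all words up to the critical length. -/
def HoldsInShortWords (D : ℕ × ℕ × List (List ℤ)) (θ : MSOFormula) : Prop :=
  ∀ N < lengthBound D θ + 1, ∀ w < letterBound D ^ lengthBound D θ,
    (∀ k < N, IsLetter D (baseDigit (letterBound D) w k)) →
      θ.CodedSat (wordLt₁ (baseDigit (letterBound D) w)) (wordLt₂ (baseDigit (letterBound D) w)) N 0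

theorem track_zero (i : ℕ) : track 0 i = ∅ := by
  ext a
  simp [track, baseDigit]

theorem codedSat_zero {R₁ R₂ : ℕ → ℕ → Prop} {n : ℕ} {θ : MSOFormula} :
    θ.CodedSat R₁ R₂ n 0 ↔ θ.RelSat R₁ R₂ n (fun _ => ∅) fun _ => ∅ := by
  simp only [MSOFormula.CodedSat, track_zero]

theorem relSat_congr_rel {R₁ R₂ S₁ S₂ : ℕ → ℕ → Prop} {n : ℕ}
    (h₁ : ∀ a < n, ∀ b < n, R₁ a b ↔ S₁ a b) (h₂ : ∀ a < n, ∀ b < n, R₂ a b ↔ S₂ a b)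
    (φ : MSOFormula) {v V : ℕ → Set ℕ} : φ.RelSat R₁ R₂ n v V ↔ φ.RelSat S₁ S₂ n v V := by
  induction φ generalizing v V with
  | eq | mem => rfl
  | lt₁ x y =>
    exact exists_congr fun a => and_congr_right fun ha => exists_congr fun b =>
      and_congr_right fun hb => and_congr_right' (and_congr_right' (h₁ a ha b hb))
  | lt₂ x y =>
    exact exists_congr fun a => and_congr_right fun ha => exists_congr fun b =>
      and_congr_right fun hb => and_congr_right' (and_congr_right' (h₂ a ha b hb))
  | neg φ ih => exact not_congr ih
  | conj φ ψ h h' | disj φ ψ h h' | imp φ ψ h h' | iff φ ψ h h' =>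
    simp only [MSOFormula.RelSat, h, h']
  | ex x φ ih | all x φ ih | exSet x φ ih | allSet x φ ih => simp only [MSOFormula.RelSat, ih]

/-- The automaton for the negation of `θ` has at most `lengthBound D θ` states, so a violating word
can be pumped down to that length. Pumping only reuses letters of the given word, so the short word
is again one over the letters of `D`. -/
theorem holdsInShortWords_iff (D : ℕ × ℕ × List (List ℤ)) (θ : MSOFormula) :
    HoldsInShortWords D θ ↔ ∀ (N : ℕ) (g : ℕ → ℕ), (∀ k < N, IsLetter D (g k)) →
      θ.RelSat (wordLt₁ g) (wordLt₂ g) N (fun _ => ∅) fun _ => ∅ := by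
  constructor
  · intro h N g hg
    by_contra hθ
    have hL : 0 < letterBound D := by unfold letterBound; positivity
    have ext : ∀ {n : ℕ} {g g' : ℕ → ℕ}, (∀ k < n, g k = g' k) →
        (θ.RelSat (wordLt₁ g) (wordLt₂ g) n (fun _ => ∅) (fun _ => ∅) ↔
          θ.RelSat (wordLt₁ g') (wordLt₂ g') n (fun _ => ∅) fun _ => ∅) := fun hgg' =>
      relSat_congr_rel (fun a ha b hb => by simp only [wordLt₁, hgg' a ha, hgg' b hb])
        (fun a ha b hb => by simp only [wordLt₂, hgg' a ha, hgg' b hb]) θ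
    -- The automaton needs a finite alphabet. The default letter occurs only from position `N` on,
    -- where it has no influence.
    let G : ℕ → Fin (letterBound D) := fun k => if h : g k < letterBound D then ⟨g k, h⟩ else ⟨0, hL⟩
    have hG : ∀ k < N, (G k : ℕ) = g k := fun k hk => by
      simp only [G, (hg k hk).lt_letterBound, dite_true]
    have hrec := (MSOFormula.recognizedBy_relSat
      (fun l : Fin (letterBound D) => (l : ℕ).unpair.1) (fun l => (l : ℕ).unpair.2) θ).not
    obtain ⟨G', N', hN', hG', hθ'⟩ := hrec.exists_short (g := G) (n := N)
      fun h' => hθ ((ext hG).1 h')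
    rw [Fintype.card_fin] at hN'
    obtain ⟨w, hw, hwd⟩ := exists_baseDigit (letterBound D) (fun k => (G' k : ℕ))
      (fun k => (G' k).2) (lengthBound D θ)
    have hwd' : ∀ k < N', baseDigit (letterBound D) w k = G' k := fun k hk =>
      hwd k (hk.trans_le hN')
    refine hθ' ((ext hwd').1 (codedSat_zero.1 (h N' (Nat.lt_succ_of_le hN') w hw fun k hk => ?_)))
    obtain ⟨k', hk', e⟩ := hG' k hk
    rw [hwd' k hk, e, hG k' hk']
    exact hg k' hk'
  · intro h N _ w _ hw
    exact codedSat_zero.2 (h N _ hw)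

theorem primrec_toNat : Primrec MSOFormula.toNat :=
  Primrec.of_equiv (e := MSOFormula.equivNat)

section

variable {α : Type} [Primcodable α]

theorem primrecPred_isLetter {D : α → ℕ × ℕ × List (List ℤ)} {l : α → ℕ} (hD : Primrec D)
    (hl : Primrec l) : PrimrecPred fun a => IsLetter (D a) (l a) := by
  have m : Primrec fun a => (D a).1 := Primrec.fst.comp hD
  have n : Primrec fun a => (D a).2.1 := Primrec.fst.comp (Primrec.snd.comp hD)
  have rows : Primrec fun a => (D a).2.2 := Primrec.snd.comp (Primrec.snd.comp hD)
  have c := hl.unpair_fst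
  have r := hl.unpair_snd
  have two : Primrec fun _ : α => 2 := .const 2
  have entry : Primrec fun a =>
      halfCellEntry (D a).1 (D a).2.2 (l a).unpair.1 (l a).unpair.2 :=
    (Primrec.list_getD (0 : ℤ)).comp ((Primrec.list_getD ([] : List ℤ)).comp rows
      (Primrec.nat_sub.comp (Primrec.nat_sub.comp m (.const 1)) (Primrec.nat_div.comp r two)))
      (Primrec.nat_div.comp c two)
  have par : PrimrecPred fun a => (l a).unpair.1 % 2 = (l a).unpair.2 % 2 :=
    .nat_eq (Primrec.nat_mod.comp c two) (Primrec.nat_mod.comp r two)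
  exact (Primrec.nat_lt.comp c (Primrec.nat_mul.comp two n)).and <|
    (Primrec.nat_lt.comp r (Primrec.nat_mul.comp two m)).and <|
      ((Primrec.eq.comp entry (.const 1)).and par).or
        ((Primrec.eq.comp entry (.const (-1))).and par.not)

theorem primrecPred_codedSat_zero {n L w : α → ℕ} {θ : α → MSOFormula} (hn : Primrec n)
    (hL : Primrec L) (hw : Primrec w) (hθ : Primrec θ) :
    PrimrecPred fun a => (θ a).CodedSat (wordLt₁ (baseDigit (L a) (w a)))
      (wordLt₂ (baseDigit (L a) (w a))) (n a) 0 := by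
  have c : Primrec fun a => (θ a).toNat := primrec_toNat.comp hθ
  -- The argument of the recursion for `θ` itself, with its own Gödel number as the bound `c` and
  -- the empty assignment, coded by `0`.
  have i : Primrec fun a => (θ a).toNat * 2 ^ MSOFormula.bitBound (θ a).toNat (n a) :=
    Primrec.nat_mul.comp c ((Primrec.const 2).pow (Primrec₂.natPair.comp (Primrec.succ.comp
      (Primrec.succ.comp (Primrec.nat_mul.comp (.const 2) c))) hn))
  refine (MSOFormula.primrecPred_codedSat.comp
    ((c.pair (hn.pair (hL.pair hw))).pair i)).of_eq fun a => ?_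
  simp only [Nat.mul_div_cancel _ (Nat.two_pow_pos _), Nat.mul_mod_left, le_refl, true_and,
    MSOFormula.ofCode_toNat]

end

theorem primrecPred_holdsInShortWords :
    PrimrecPred fun p : (ℕ × ℕ × List (List ℤ)) × MSOFormula => HoldsInShortWords p.1 p.2 := by
  have D : Primrec fun p : (ℕ × ℕ × List (List ℤ)) × MSOFormula => p.1 := .fst
  have L : Primrec fun p : (ℕ × ℕ × List (List ℤ)) × MSOFormula => letterBound p.1 :=
    Primrec.pow (Primrec.succ.comp (Primrec.nat_add.comp
      (Primrec.nat_mul.comp (.const 2) (Primrec.fst.comp D))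
      (Primrec.nat_mul.comp (.const 2) (Primrec.fst.comp (Primrec.snd.comp D))))) (.const 2)
  have S : Primrec fun p : (ℕ × ℕ × List (List ℤ)) × MSOFormula => lengthBound p.1 p.2 :=
    primrec_stateBound L (primrec_toNat.comp .snd)
  have f1 : Primrec fun q : (((ℕ × ℕ × List (List ℤ)) × MSOFormula) × ℕ) × ℕ => q.1.1 :=
    Primrec.fst.comp .fst
  have f2 : Primrec fun q : (((ℕ × ℕ × List (List ℤ)) × MSOFormula) × ℕ) × ℕ => q.1.2 :=
    Primrec.snd.comp .fst
  refine .forall_lt_of (Primrec.succ.comp S) <| .forall_lt_of ((L.pow S).comp .fst) <| .imp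
    (.forall_lt_of f2 ?_) ?_
  · exact primrecPred_isLetter (D.comp (f1.comp .fst))
      (.baseDigit (L.comp (f1.comp .fst)) (Primrec.snd.comp .fst) .snd)
  · exact primrecPred_codedSat_zero f2 (L.comp f1) .snd (Primrec.snd.comp f1)

/-- There is a single algorithm that, given a matrix `M` with entries in `{0, 1, -1}` and a monadic
second-order sentence `θ` in the language of permutations, decides whether `θ` belongs to the
theory of the geometric grid class of `M`. -/
theorem mainTheorem5 :
    ∃ f : (ℕ × ℕ × List (List ℤ)) × MSOFormula → Bool, Computable f ∧
      ∀ (m n : ℕ) (M : Matrix (Fin m) (Fin n) SignType) (θ : MSOFormula), θ.IsSentence →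
        (f (matrixData M, θ) = true ↔ θ ∈ msoTheory (geomClass M)) := by
  obtain ⟨_, h⟩ := primrecPred_holdsInShortWords
  refine ⟨_, h.to_comp, fun m n M θ hθ => ?_⟩
  exact decide_eq_true_iff.trans
    ((holdsInShortWords_iff _ _).trans (mem_msoTheory_geomClass_iff M hθ).symm)
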